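/- Let $A=F(X)$ and $B=F(Y)$ be free groups with finite bases $X$ and $Y$, let $C$ be a finitely generated group with monomorphisms $\varphi\colon C\to A$ and $\psi\colon C\to B$, and let $G=A*_C B$ be the corresponding amalgamated product, with $A$, $B$, $C$ identified with their images in $G$. Write $H^g=g^{-1}Hg$ and $h^g=g^{-1}hg$. Put $N^*_G(C)=\{g\in G : C\cap C^g\neq 1\}$ and $Z_G(C)=\bigcup_{g\in N^*_G(C)\smallsetminus C}\{h\in C : h^g\in C\}$. An element of $G$ is called *regular* if it does not lie in $(N^*_G(C)\smallsetminus C)\cup Z_G(C)$. A *reduced form* of $g\in G$ is an expression $g=cg_1\cdots g_n$ with $n\ge 0$, $c\in C$, $g_i\in(A\cup B)\smallsetminus C$, and consecutive $g_i$ in different factors; $g$ is *cyclically reduced* if it has a reduced form such that $n=0$, or $n=1$ and $g$ is not conjugate in $G$ to an element of $C$, or $n\ge 2$ and $g_1$, $g_n$ lie in different factors. Let $CR\subseteq G$ be the set of all conjugates of cyclically reduced regular elements. Then the conjugacy search problem in $G$ is decidable for all pairs in $CR\times G$. That is, there is a partial algorithm which takes as input pairs $(u,v)$ of words in the alphabet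 $(X\cup Y)^{\pm1}$ and has the following properties: 1. Whenever it halts on $(u,v)$, its output is correct: it either states that $u$ and $v$ are not conjugate in $G$, and they are not, or it returns a word $z$ with $z^{-1}uz=v$ in $G$. 2. It halts on every pair $(u,v)$ such that $u$ represents an element of $CR$. -/

import Mathlib

universe u v

section GeneralizedNormalizer

variable {G : Type u} [Group G]

/-- The conjugate `H ^ g = g⁻¹ H g`. -/
def conjSubgroup (H : Subgroup G) (g : G) : Subgroup G :=
  H.map (MulAut.conj g⁻¹).toMonoidHom

/-- The generalized normalizer `N*_G(H) = {g | H ∩ H ^ g ≠ 1}`. -/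
def genNormalizer (H : Subgroup G) : Set G :=
  {g | H ⊓ conjSubgroup H g ≠ ⊥}

/-- `Z_g(H) = {h ∈ H | h ^ g ∈ H}`, where `h ^ g = g⁻¹ h g`. -/
def zAt (H : Subgroup G) (g : G) : Set G :=
  {h | h ∈ H ∧ g⁻¹ * h * g ∈ H}

/-- `Z_G(H)`, the union of the sets `Z_g(H)` over all `g ∈ N*_G(H) \ H`. -/
def zSet (H : Subgroup G) : Set G :=
  ⋃ g ∈ genNormalizer H \ (H : Set G), zAt H g

/-- The black hole `(N*_G(H) \ H) ∪ Z_G(H)`; its elements are called singular. -/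
def blackHole (H : Subgroup G) : Set G :=
  (genNormalizer H \ (H : Set G)) ∪ zSet H

/-- An element is regular (with respect to `H`) if it is not in the black hole. -/
def IsRegularElt (H : Subgroup G) (g : G) : Prop :=
  g ∉ blackHole H

end GeneralizedNormalizer

section Amalgam

/-- The family consisting of the two factors `A` (index `false`) and `B` (index `true`). -/
def Factor (A B : Type u) : Bool → Type u
  | false => A
  | true => B

instance instGroupFactor (A B : Type u) [Group A] [Group B] : ∀ i, Group (Factor A B i)
  | false => (inferInstance : Group A)
  | true => (inferInstance : Group B)

variable {A B : Type u} {C : Type v} [Group A] [Group B] [Group C]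

/-- The two maps `φ : C → A` and `ψ : C → B` as one family. -/
def factorHom (φ : C →* A) (ψ : C →* B) : ∀ i, C →* Factor A B i
  | false => φ
  | true => ψ

/-- The amalgamated product `A *_C B` with respect to `φ : C → A` and `ψ : C → B`. -/
abbrev Amalgam (φ : C →* A) (ψ : C →* B) : Type (max u v) :=
  Monoid.PushoutI (factorHom φ ψ)

namespace Amalgam

variable (φ : C →* A) (ψ : C →* B)

/-- The canonical map `A → A *_C B`. -/
def inl : A →* Amalgam φ ψ :=
  Monoid.PushoutI.of (φ := factorHom φ ψ) false

/-- The canonical map `B → A *_C B`. -/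
def inr : B →* Amalgam φ ψ :=
  Monoid.PushoutI.of (φ := factorHom φ ψ) true

/-- The amalgamated subgroup `C` of `A *_C B`. -/
def amalgamated : Subgroup (Amalgam φ ψ) :=
  (Monoid.PushoutI.base (factorHom φ ψ)).range

/-- `g = c g₁ ⋯ gₙ` is a reduced form: `c ∈ C`, every `gᵢ` lies in `(A ∪ B) \ C`, and consecutive
`gᵢ` lie in different factors. (The word `w = g₁ ⋯ gₙ` is a list of elements of the factors, each
tagged with its factor; the last condition is a field of `Monoid.CoprodI.Word`.) -/
def IsReducedForm (g : Amalgam φ ψ) (c : C) (w : Monoid.CoprodI.Word (Factor A B)) : Prop :=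
  Monoid.PushoutI.Reduced (factorHom φ ψ) w ∧
    g = Monoid.PushoutI.base (factorHom φ ψ) c * Monoid.PushoutI.ofCoprodI w.prod

/-- `g` has a reduced form `c g₁ ⋯ gₙ` such that `n = 0`, or `n = 1` and `g` is not conjugate to
an element of `C`, or `n ≥ 2` and `g₁`, `gₙ` lie in different factors. -/
def IsCyclicallyReduced (g : Amalgam φ ψ) : Prop :=
  ∃ (c : C) (w : Monoid.CoprodI.Word (Factor A B)), IsReducedForm φ ψ g c w ∧
    (w.toList.length = 0 ∨
      (w.toList.length = 1 ∧ ∀ x ∈ amalgamated φ ψ, ¬ IsConj g x) ∨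
      (2 ≤ w.toList.length ∧
        ∃ a ∈ w.toList.head?, ∃ b ∈ w.toList.getLast?, a.1 ≠ b.1))

/-- The set `CR` of all conjugates of cyclically reduced regular elements of `A *_C B`. -/
def CR : Set (Amalgam φ ψ) :=
  {g | ∃ g₀, IsCyclicallyReduced φ ψ g₀ ∧ IsRegularElt (amalgamated φ ψ) g₀ ∧ IsConj g₀ g}

end Amalgam

end Amalgam

section SearchProblem

/-- Words over the alphabet `X ∪ X⁻¹`; the letter `(x, true)` is `x` and `(x, false)` is `x⁻¹`. -/
abbrev GroupWord (X : Type u) : Type u := List (X × Bool)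

/-- The element of `G` represented by a word, when the letter `x` stands for `γ x`. -/
def GroupWord.eval {X : Type u} {G : Type v} [Group G] (γ : X → G) (w : GroupWord X) : G :=
  FreeGroup.lift γ (FreeGroup.mk w)

/-- The correct answers to "are `u` and `v` conjugate, and if so, by which element?": `none` means
that they are not conjugate, and `some z` that `z` is a word with `z⁻¹ u z = v`. -/
def IsConjSearchAnswer {X : Type u} {G : Type v} [Group G] (γ : X → G) (u v : GroupWord X) :
    Option (GroupWord X) → Prop
  | none => ¬ IsConj (u.eval γ) (v.eval γ)
  | some z => (z.eval γ)⁻¹ * u.eval γ * z.eval γ = v.eval γ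

/-- The conjugacy search problem in `G` is decidable on the set of pairs `Φ`: there is a partial
algorithm, whose inputs are pairs of words, which gives a correct answer whenever it halts, and
which halts on every pair of words that represents a pair in `Φ`. -/
def ConjSearchDecidableOn {X : Type u} [Primcodable X] {G : Type v} [Group G] (γ : X → G)
    (Φ : Set (G × G)) : Prop :=
  ∃ f : GroupWord X × GroupWord X →. Option (GroupWord X), Partrec f ∧
    (∀ u v, ∀ r ∈ f (u, v), IsConjSearchAnswer γ u v r) ∧
    (∀ u v, (u.eval γ, v.eval γ) ∈ Φ → (f (u, v)).Dom)

/-- The standard generators `X ∪ Y` of `A *_C B`, where `A = F(X)` and `B = F(Y)`. -/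
def Amalgam.gen {X Y : Type u} {C : Type v} [Group C] (φ : C →* FreeGroup X)
    (ψ : C →* FreeGroup Y) : X ⊕ Y → Amalgam φ ψ :=
  Sum.elim (fun x => Amalgam.inl φ ψ (FreeGroup.of x)) (fun y => Amalgam.inr φ ψ (FreeGroup.of y))

end SearchProblem

/-! The algorithm enumerates pairs of words `(s, t)`. It tests whether `s` conjugates `u` to `v`,
and otherwise whether `u' = u^s` and `v' = v^t` carry a checkable proof of non-conjugacy
(`NonConjCertificate`). Normal forms, and with them the word problem and membership in `C`, are
computable because `C` is undistorted in both free factors.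

The certificate asks that `v'` has at most one syllable or starts and ends in different factors,
that no word of length at most `B` conjugates `u'` to `v'`, and one of three things about `u'`: it
is trivial; or it has at most one syllable and every short `z` with `z⁻¹ u' z ∈ C` lies in `C`; or
it starts and ends in different factors and no short nontrivial `z ∈ C` has `u'⁻¹ z u' ∈ C`.

Soundness means that, under these conditions, conjugate elements have a short conjugator. If `u'`
has at most one syllable, a conjugator must lie in a factor containing `u'`
(`exists_of_conj_elliptic`), and conjugators in free groups can be shortened. If `u'` starts and
ends in different factors, some `e ∈ C` conjugates a cyclic permutation of `v'` to `u'`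
(`exists_rotation`). Two such `e`, for the same permutation, differ by an element of `C ∩ u' C u'⁻¹
= 1`, so `e` is unique; a long `e` could be shortened (`exists_pump`), hence `e` is short.

All shortening is pumping in trees. Finitely generated subgroups of free groups are quasiconvex, so
a long geodesic that ends in `C` has points of `C` near all its vertices. By pigeonhole the same
bounded data occur at two of them, and the stretch between can be cut out. Pumping also shows that
the tests on short `z` imply the same conditions for all `z` that matter.

Completeness: for a regular cyclically reduced `u'` the conditions hold for all `z`, by the
definition of the black hole, and every `v` has a conjugate `v'` of the required shape
(`exists_conj_cycTags`). -/

open Monoid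

set_option linter.unusedSectionVars false

/-! ### Reduced forms in an amalgamated product -/

section Syllables

variable {M : Bool → Type*} [∀ i, Group (M i)] {H : Type*} [Group H] {θ : ∀ i, H →* M i}

/-- A list of syllables, that is, of elements of the factors tagged with their factor. -/
abbrev Syl (M : Bool → Type*) := List (Σ i, M i)

/-- The factors of the syllables. -/
def Syl.tags (l : Syl M) : List Bool := l.map Sigma.fst

/-- The product of a list of syllables in the pushout. -/
def Syl.prod (θ : ∀ i, H →* M i) (l : Syl M) : PushoutI θ :=
  (l.map fun s => PushoutI.of s.1 s.2).prod

/-- The inverse list of syllables. -/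
def Syl.inv (l : Syl M) : Syl M := (l.map fun s => ⟨s.1, s.2⁻¹⟩ : Syl M).reverse

/-- No syllable lies in the amalgamated subgroup and adjacent syllables are in different factors. -/
def Syl.IsRed (θ : ∀ i, H →* M i) (l : Syl M) : Prop :=
  (∀ s ∈ l, s.2 ∉ (θ s.1).range) ∧ l.tags.IsChain (· ≠ ·)

/-- The tags of a cyclically reduced list of syllables. -/
def CycTags (L : List Bool) : Prop := L.length ≤ 1 ∨ L.head? ≠ L.getLast?

namespace Syl

@[simp] lemma tags_nil : tags ([] : Syl M) = [] := rfl
@[simp] lemma tags_cons (s : Σ i, M i) (l : Syl M) : tags (s :: l) = s.1 :: tags l := rfl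
@[simp] lemma tags_append (l l' : Syl M) : tags (l ++ l') = tags l ++ tags l' := by simp [tags]
@[simp] lemma length_tags (l : Syl M) : (tags l).length = l.length := by simp [tags]
@[simp] lemma tags_inv (l : Syl M) : tags (inv l) = (tags l).reverse := by
  simp [tags, inv, Function.comp_def]

@[simp] lemma prod_nil : prod θ ([] : Syl M) = 1 := rfl
@[simp] lemma prod_cons (s : Σ i, M i) (l : Syl M) :
    prod θ (s :: l) = PushoutI.of s.1 s.2 * prod θ l := by simp [prod]
@[simp] lemma prod_append (l l' : Syl M) : prod θ (l ++ l') = prod θ l * prod θ l' := by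
  simp [prod]
@[simp] lemma prod_inv (l : Syl M) : prod θ (inv l) = (prod θ l)⁻¹ := by
  induction l with
  | nil => simp [inv]
  | cons s t ih =>
    have : inv (s :: t) = inv t ++ [⟨s.1, s.2⁻¹⟩] := by simp [inv]
    rw [this, prod_append, ih]; simp

lemma isRed_nil : IsRed θ ([] : Syl M) := ⟨by simp, List.isChain_nil⟩

lemma isRed_singleton {i : Bool} {g : M i} (h : g ∉ (θ i).range) :
    IsRed θ ([⟨i, g⟩] : Syl M) := ⟨by simpa using h, by simp⟩

lemma IsRed.inv {l : Syl M} (h : IsRed θ l) : IsRed θ l.inv := by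
  refine ⟨?_, ?_⟩
  · intro s hs
    simp only [Syl.inv, List.mem_reverse, List.mem_map] at hs
    obtain ⟨t, ht, rfl⟩ := hs
    simpa using h.1 t ht
  · rw [tags_inv, List.isChain_reverse]
    simpa [ne_comm] using h.2

lemma IsRed.tail {s : Σ i, M i} {l : Syl M} (h : IsRed θ (s :: l)) : IsRed θ l :=
  ⟨fun t ht => h.1 t (List.mem_cons_of_mem _ ht), (List.isChain_cons.1 h.2).2⟩

lemma isRed_append_iff {l l' : Syl M} : IsRed θ (l ++ l') ↔
    (IsRed θ l ∧ IsRed θ l') ∧ ∀ x ∈ l.tags.getLast?, ∀ y ∈ l'.tags.head?, x ≠ y := by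
  simp only [IsRed, tags_append, List.isChain_append, List.mem_append]
  constructor
  · rintro ⟨h1, h2, h3, h4⟩
    exact ⟨⟨⟨fun s hs => h1 s (.inl hs), h2⟩, fun s hs => h1 s (.inr hs), h3⟩, h4⟩
  · rintro ⟨⟨⟨h1, h2⟩, h3, h4⟩, h5⟩
    exact ⟨fun s hs => hs.elim (h1 s) (h3 s), h2, h4, h5⟩

lemma isRed_cons_iff {i : Bool} {g : M i} {l : Syl M} : IsRed θ (⟨i, g⟩ :: l) ↔
    g ∉ (θ i).range ∧ IsRed θ l ∧ ∀ j ∈ l.tags.head?, i ≠ j := by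
  have := isRed_append_iff (θ := θ) (l := [⟨i, g⟩]) (l' := l)
  rw [List.singleton_append] at this
  rw [this]
  constructor
  · rintro ⟨⟨h1, h2⟩, h3⟩
    exact ⟨h1.1 ⟨i, g⟩ (by simp), h2, fun j hj => h3 i (by simp) j hj⟩
  · rintro ⟨h1, h2, h3⟩
    exact ⟨⟨isRed_singleton h1, h2⟩, by simpa using h3⟩

/-- The normal form theorem for syllable lists; every uniqueness statement below is derived from it.
-/
lemma eq_nil_of_prod_mem (hθ : ∀ i, Function.Injective (θ i)) {l : Syl M} (h : IsRed θ l)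
    (hm : prod θ l ∈ (PushoutI.base θ).range) : l = [] := by
  classical
  let w : CoprodI.Word M :=
    { toList := l
      ne_one := fun s hs h1 => h.1 s hs (h1 ▸ one_mem _)
      chain_ne := by simpa [tags, List.isChain_map] using h.2 }
  have hw : PushoutI.Reduced θ w := h.1
  have hp : PushoutI.ofCoprodI (φ := θ) w.prod = prod θ l := by
    simp only [CoprodI.Word.prod, map_list_prod, List.map_map, prod, w]
    congr 2
  have := hw.eq_empty_of_mem_range hθ (by rw [hp]; exact hm)
  exact congrArg CoprodI.Word.toList this

lemma base_mul_of {i : Bool} (c : H) (g : M i) :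
    PushoutI.base θ c * PushoutI.of i g = PushoutI.of i (θ i c * g) := by
  rw [map_mul, PushoutI.of_apply_eq_base]

lemma of_mem_base_range (hθ : ∀ i, Function.Injective (θ i)) {i : Bool} {g : M i} :
    PushoutI.of i g ∈ (PushoutI.base θ).range ↔ g ∈ (θ i).range := by
  constructor
  · rintro ⟨c, hc⟩
    refine ⟨c, PushoutI.of_injective hθ i ?_⟩
    rw [PushoutI.of_apply_eq_base, hc]
  · rintro ⟨c, rfl⟩
    exact ⟨c, (PushoutI.of_apply_eq_base θ i c).symm⟩

/-- The amalgamated subgroup acts on the left of reduced products. -/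
lemma IsRed.base_mul {l : Syl M} (h : IsRed θ l) (c : H) :
    ∃ (l' : Syl M) (c' : H), PushoutI.base θ c * prod θ l = prod θ l' * PushoutI.base θ c' ∧
      IsRed θ l' ∧ l'.tags = l.tags := by
  cases l with
  | nil => exact ⟨[], c, by simp, isRed_nil, rfl⟩
  | cons s t =>
    obtain ⟨i, g⟩ := s
    refine ⟨⟨i, θ i c * g⟩ :: t, 1, ?_, ?_, rfl⟩
    · simp [← mul_assoc, base_mul_of]
    · rw [isRed_cons_iff] at h ⊢
      refine ⟨?_, h.2⟩
      rw [Subgroup.mul_mem_cancel_left _ (MonoidHom.mem_range.2 ⟨c, rfl⟩)]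
      exact h.1

/-- Two reduced products in the same double coset of the amalgamated subgroup start in
the same factor and their first syllables are in the same double coset. -/
lemma head_match (hθ : ∀ i, Function.Injective (θ i)) {i j : Bool} {g : M i} {h : M j}
    {t t' : Syl M} {c : H} (hl : IsRed θ (⟨i, g⟩ :: t)) (hl' : IsRed θ (⟨j, h⟩ :: t'))
    (hm : (prod θ (⟨j, h⟩ :: t'))⁻¹ * PushoutI.base θ c * prod θ (⟨i, g⟩ :: t) ∈
      (PushoutI.base θ).range) :
    i = j ∧ ∃ d, PushoutI.base θ d = (PushoutI.of j h)⁻¹ * PushoutI.base θ c * PushoutI.of i g := by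
  have hl2 := isRed_cons_iff.1 hl
  have hl2' := isRed_cons_iff.1 hl'
  by_cases hij : i = j
  · subst hij
    refine ⟨rfl, ?_⟩
    by_contra hne
    have hx : h⁻¹ * θ i c * g ∉ (θ i).range := by
      rintro ⟨d, hd⟩
      refine hne ⟨d, ?_⟩
      rw [← PushoutI.of_apply_eq_base θ i d, hd]
      simp [PushoutI.of_apply_eq_base]
    -- If the two first syllables did not cancel modulo `C`, this nonempty word would be reduced
    -- with product in `C`.
    have hr : IsRed θ (inv t' ++ ⟨i, h⁻¹ * θ i c * g⟩ :: t) := by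
      rw [isRed_append_iff, isRed_cons_iff]
      refine ⟨⟨hl2'.2.1.inv, hx, hl2.2⟩, ?_⟩
      intro x hx y hy
      simp only [tags_inv, List.getLast?_reverse] at hx
      simp only [tags_cons, List.head?_cons, Option.mem_def, Option.some.injEq] at hy
      subst hy
      exact (hl2'.2.2 x hx).symm
    have := eq_nil_of_prod_mem hθ hr (by
      convert hm using 1
      simp [PushoutI.of_apply_eq_base, mul_assoc])
    simp at this
  · exfalso
    have hr : IsRed θ (inv (⟨j, h⟩ :: t') ++ ⟨i, θ i c * g⟩ :: t) := by
      rw [isRed_append_iff, isRed_cons_iff]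
      refine ⟨⟨hl'.inv, ?_, hl2.2⟩, ?_⟩
      · rw [Subgroup.mul_mem_cancel_left _ (MonoidHom.mem_range.2 ⟨c, rfl⟩)]
        exact hl2.1
      · intro x hx y hy
        simp only [tags_inv, List.getLast?_reverse, tags_cons, List.head?_cons, Option.mem_def,
          Option.some.injEq] at hx hy
        subst hx hy
        exact fun h => hij h.symm
    have := eq_nil_of_prod_mem hθ hr (by
      convert hm using 1
      simp [PushoutI.of_apply_eq_base, mul_assoc])
    simp at this

/-- Two reduced products in the same double coset of the amalgamated subgroup have the same
sequence of factors. -/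
lemma tags_eq (hθ : ∀ i, Function.Injective (θ i)) {l l' : Syl M} {c : H}
    (hl : IsRed θ l) (hl' : IsRed θ l')
    (hm : (prod θ l')⁻¹ * PushoutI.base θ c * prod θ l ∈ (PushoutI.base θ).range) :
    l.tags = l'.tags := by
  induction l generalizing l' c with
  | nil =>
    rw [prod_nil, mul_one, Subgroup.mul_mem_cancel_right _ (MonoidHom.mem_range.2 ⟨c, rfl⟩), inv_mem_iff] at hm
    rw [eq_nil_of_prod_mem hθ hl' hm]
  | cons s t ih =>
    cases l' with
    | nil =>
      rw [prod_nil, inv_one, one_mul, Subgroup.mul_mem_cancel_left _ (MonoidHom.mem_range.2 ⟨c, rfl⟩)] at hm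
      rw [eq_nil_of_prod_mem hθ hl hm]
    | cons s' t' =>
      obtain ⟨i, g⟩ := s
      obtain ⟨j, h⟩ := s'
      obtain ⟨rfl, d, hd⟩ := head_match hθ hl hl' hm
      rw [tags_cons, tags_cons, ih hl.tail hl'.tail (c := d)]
      rw [hd]
      simpa [mul_assoc] using hm

lemma tags_eq_of_eq (hθ : ∀ i, Function.Injective (θ i)) {l l' : Syl M} {a b c d : H}
    (hl : IsRed θ l) (hl' : IsRed θ l')
    (h : PushoutI.base θ a * prod θ l * PushoutI.base θ b =
      PushoutI.base θ c * prod θ l' * PushoutI.base θ d) :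
    l.tags = l'.tags := by
  refine tags_eq hθ (c := c⁻¹ * a) hl hl' ⟨d * b⁻¹, ?_⟩
  have : prod θ l = (PushoutI.base θ a)⁻¹ *
      (PushoutI.base θ c * prod θ l' * PushoutI.base θ d) * (PushoutI.base θ b)⁻¹ := by
    rw [← h]; group
  rw [this]
  simp only [map_mul, map_inv]
  group

/-- Left multiplication by a generator preserves the existence of a form: a factor element merges
with a first syllable of its own factor, and whatever falls into the amalgamated subgroup is pushed
to the right end by `IsRed.base_mul`. -/
lemma exists_form (g : PushoutI θ) :
    ∃ (l : Syl M) (c : H), g = prod θ l * PushoutI.base θ c ∧ IsRed θ l := by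
  suffices ∀ x y : PushoutI θ, (∃ (l : Syl M) (c : H), y = prod θ l * PushoutI.base θ c ∧
      IsRed θ l) → ∃ (l : Syl M) (c : H), x * y = prod θ l * PushoutI.base θ c ∧ IsRed θ l by
    simpa using this g 1 ⟨[], 1, by simp, isRed_nil⟩
  intro x
  induction x using PushoutI.induction_on with
  | of i a =>
    rintro _ ⟨l, c, rfl, hl⟩
    by_cases h : ∃ (b : M i) (t : Syl M), l = ⟨i, b⟩ :: t
    · obtain ⟨b, t, rfl⟩ := h
      by_cases hab : a * b ∈ (θ i).range
      · obtain ⟨e, he⟩ := hab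
        obtain ⟨l', c', h1, h2, -⟩ := hl.tail.base_mul e
        refine ⟨l', c' * c, ?_, h2⟩
        rw [map_mul, ← mul_assoc (prod θ l'), ← h1, ← PushoutI.of_apply_eq_base θ i e, he]
        simp [mul_assoc]
      · refine ⟨⟨i, a * b⟩ :: t, c, by simp [mul_assoc], ?_⟩
        rw [isRed_cons_iff] at hl ⊢
        exact ⟨hab, hl.2⟩
    · by_cases ha : a ∈ (θ i).range
      · obtain ⟨e, rfl⟩ := ha
        obtain ⟨l', c', h1, h2, -⟩ := hl.base_mul e
        refine ⟨l', c' * c, ?_, h2⟩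
        rw [map_mul, ← mul_assoc (prod θ l'), ← h1, ← PushoutI.of_apply_eq_base θ i e]
        simp [mul_assoc]
      · refine ⟨⟨i, a⟩ :: l, c, by simp [mul_assoc], ?_⟩
        rw [isRed_cons_iff]
        refine ⟨ha, hl, ?_⟩
        rintro j hj rfl
        cases l with
        | nil => simp at hj
        | cons s t =>
          obtain ⟨k, b⟩ := s
          simp only [tags_cons, List.head?_cons, Option.mem_def, Option.some.injEq] at hj
          subst hj
          exact h ⟨b, t, rfl⟩
  | base e =>
    rintro _ ⟨l, c, rfl, hl⟩
    obtain ⟨l', c', h1, h2, -⟩ := hl.base_mul e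
    exact ⟨l', c' * c, by rw [map_mul, ← mul_assoc, ← mul_assoc, h1], h2⟩
  | mul x y hx hy =>
    intro z hz
    rw [mul_assoc]
    exact hx _ (hy _ hz)

/-- The sequence of factors of a conjugate without cancellation. -/
lemma tags_conj (hθ : ∀ i, Function.Injective (θ i)) {t core l' : Syl M} {c d : H}
    (hr : IsRed θ (inv t ++ core ++ t)) (hl' : IsRed θ l')
    (h : (prod θ t * PushoutI.base θ c)⁻¹ * prod θ core * (prod θ t * PushoutI.base θ c) =
      PushoutI.base θ d * prod θ l') :
    l'.tags = t.tags.reverse ++ core.tags ++ t.tags := by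
  have := tags_eq_of_eq hθ (a := c⁻¹) (b := c) (c := d) (d := 1) hr hl' (by
    rw [map_one, mul_one, ← h]
    simp [mul_assoc])
  rw [← this]
  simp

/-- A conjugate without cancellation starts and ends in the same factor; this is the source of all
contradictions in the analysis of conjugators. -/
lemma not_cycTags {t core : List Bool} (h : core.head? = core.getLast?)
    (hlen : 2 ≤ core.length ∨ (core ≠ [] ∧ t ≠ [])) :
    ¬ CycTags (t.reverse ++ core ++ t) := by
  rintro (h1 | h1)
  · simp only [List.length_append, List.length_reverse] at h1
    rcases hlen with h2 | ⟨h2, h3⟩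
    · omega
    · have := List.length_pos_of_ne_nil h2
      have := List.length_pos_of_ne_nil h3
      omega
  · apply h1
    cases t with
    | nil => simpa using h
    | cons a t =>
      simp [List.head?_append, List.getLast?_append, List.getLast?_cons]

end Syl
end Syllables

/-! ### Conjugators between cyclically reduced elements -/

section Conjugacy

variable {M : Bool → Type*} [∀ i, Group (M i)] {H : Type*} [Group H] {θ : ∀ i, H →* M i}

namespace Syl

lemma getLast?_cons_append_singleton {α : Type*} (a b : α) (m : List α) :
    (a :: (m ++ [b])).getLast? = some b := by
  rw [← List.cons_append, List.getLast?_append]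
  simp

lemma bool_eq_or_eq {j k : Bool} (h : j ≠ k) (i : Bool) : i = j ∨ i = k := by
  revert i j k
  decide

lemma exists_eq_cons_append_singleton {l : Syl M} (hh : l.tags.head? ≠ l.tags.getLast?) :
    ∃ a m b, l = a :: (m ++ [b]) ∧ a.1 ≠ b.1 := by
  cases l with
  | nil => simp at hh
  | cons a t =>
    rcases List.eq_nil_or_concat t with rfl | ⟨m, b, rfl⟩
    · simp at hh
    · refine ⟨a, m, b, by simp, fun h => hh ?_⟩
      simp only [List.concat_eq_append, tags_cons, tags_append, tags_nil, List.head?_cons, h]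
      rw [← List.cons_append, List.getLast?_append]
      simp

/-- Conjugates of a cyclically reduced element `u` of length at least `2`: a cyclically reduced
conjugate is conjugate by the amalgamated subgroup to a cyclic permutation of `u`. -/
theorem exists_rotation (hθ : ∀ i, Function.Injective (θ i)) {l lz l' : Syl M} {c d : H}
    (hl : IsRed θ l) (hh : l.tags.head? ≠ l.tags.getLast?) (hz : IsRed θ lz)
    (hl' : IsRed θ l') (hc : CycTags l'.tags)
    (h : (prod θ lz * PushoutI.base θ c)⁻¹ * prod θ l * (prod θ lz * PushoutI.base θ c) =
      PushoutI.base θ d * prod θ l') :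
    ∃ l₁ e, l ~r l₁ ∧ IsRed θ l₁ ∧ (PushoutI.base θ e)⁻¹ * prod θ l₁ * PushoutI.base θ e =
      PushoutI.base θ d * prod θ l' := by
  induction hn : lz.length generalizing l lz c with
  | zero =>
    obtain rfl := List.length_eq_zero_iff.1 hn
    exact ⟨l, c, List.IsRotated.refl l, hl, by simpa using h⟩
  | succ n ih =>
    obtain ⟨⟨i, s⟩, t, rfl⟩ := List.exists_cons_of_length_eq_add_one hn
    obtain ⟨⟨j, a⟩, m, ⟨k, b⟩, rfl, hjk⟩ := exists_eq_cons_append_singleton hh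
    simp only at hjk
    have hz2 := isRed_cons_iff.1 hz
    have hl2 := isRed_cons_iff.1 hl
    have hl3 := isRed_append_iff.1 hl2.2.1
    have hl4 := isRed_append_iff.1 (show IsRed θ ((⟨j, a⟩ :: m) ++ [⟨k, b⟩]) from hl)
    have hlast : ∀ x ∈ (inv t).tags.getLast?, x ≠ i := by
      intro x hx
      rw [tags_inv, List.getLast?_reverse] at hx
      exact (hz2.2.2 x hx).symm
    rcases bool_eq_or_eq hjk i with rfl | rfl
    -- If `s⁻¹ * a ∈ C`, then conjugation by `s` is, up to `C`, the rotation of `a` to the end, and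
    -- the conjugator loses a syllable.
    · by_cases hs : s⁻¹ * a ∈ (θ i).range
      · obtain ⟨e, he⟩ := hs
        have hee : PushoutI.base θ e⁻¹ = (PushoutI.of i a)⁻¹ * PushoutI.of i s := by
          rw [← PushoutI.of_apply_eq_base θ i, map_inv, he]; simp
        obtain ⟨t', c', h1, h2, h3⟩ := hz.tail.base_mul e⁻¹
        have hrot : (⟨i, a⟩ :: (m ++ [⟨k, b⟩]) : Syl M) ~r ((m ++ [⟨k, b⟩]) ++ [⟨i, a⟩]) :=
          ⟨1, by simp⟩
        obtain ⟨l₁, e', h5, h6, h7⟩ := ih (l := (m ++ [⟨k, b⟩]) ++ [⟨i, a⟩]) (lz := t')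
          (c := c' * c) (by
            rw [isRed_append_iff]
            exact ⟨⟨hl2.2.1, isRed_singleton hl2.1⟩, by simpa using hjk.symm⟩) (by
            cases m with
            | nil => simpa using hjk.symm
            | cons x m =>
              have := hl2.2.2 x.1 (by simp)
              simp
              rw [← List.cons_append, List.getLast?_append]
              simpa using this.symm) h2 (by
            rw [← h, map_mul, ← mul_assoc (prod θ t'), ← h1, hee]
            simp [mul_assoc]) (by
            have := congrArg List.length h3
            simp at this hn
            omega)
        exact ⟨l₁, e', hrot.trans h5, h6, h7⟩
      · exfalso
        -- Otherwise nothing cancels and the core starts and ends in factor `i`, so the conjugate is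
        -- not cyclically reduced.
        have hr : IsRed θ (inv t ++ (⟨i, s⁻¹ * a⟩ :: ((m ++ [⟨k, b⟩]) ++ [⟨i, s⟩])) ++ t) := by
          rw [isRed_append_iff, isRed_append_iff, isRed_cons_iff, isRed_append_iff]
          refine ⟨⟨⟨⟨hz.tail.inv, hs, ⟨⟨hl2.2.1, isRed_singleton hz2.1⟩, ?_⟩, ?_⟩, ?_⟩,
            hz.tail⟩, ?_⟩
          · simpa using hjk.symm
          · simpa using hl2.2.2
          · simpa using hlast
          · simp only [tags_append, tags_cons, tags_nil, List.getLast?_append,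
              getLast?_cons_append_singleton]
            simpa using hz2.2.2
        have := tags_conj hθ (c := c) (d := d) hr hl' (by
          rw [← h]; simp [mul_assoc])
        rw [this] at hc
        refine not_cycTags ?_ (.inl (by simp)) hc
        simp only [tags_append, tags_cons, tags_nil, List.head?_cons,
          getLast?_cons_append_singleton]
    -- The mirror case: `s` cancels against the last syllable, which rotates to the front.
    · by_cases hs : b * s ∈ (θ i).range
      · obtain ⟨e, he⟩ := hs
        have hee : PushoutI.base θ e = PushoutI.of i b * PushoutI.of i s := by
          rw [← PushoutI.of_apply_eq_base θ i, he, map_mul]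
        obtain ⟨t', c', h1, h2, h3⟩ := hz.tail.base_mul e
        have hrot : (⟨j, a⟩ :: (m ++ [⟨i, b⟩]) : Syl M) ~r (⟨i, b⟩ :: (⟨j, a⟩ :: m)) :=
          List.IsRotated.symm ⟨1, by simp⟩
        obtain ⟨l₁, e', h5, h6, h7⟩ := ih (l := ⟨i, b⟩ :: (⟨j, a⟩ :: m)) (lz := t')
          (c := c' * c) (by
            rw [isRed_cons_iff]
            exact ⟨hl4.1.2.1 ⟨i, b⟩ (by simp), hl4.1.1, by simpa using hjk.symm⟩) (by
            have := hl4.2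
            rw [tags_cons, List.head?_cons, List.getLast?_cons]
            intro h
            have h8 : i ∈ (tags (⟨j, a⟩ :: m)).getLast? := by
              rw [tags_cons, List.getLast?_cons] at h ⊢
              simpa using h.symm
            exact this i h8 i (by simp) rfl) h2 (by
            rw [← h, map_mul, ← mul_assoc (prod θ t'), ← h1, hee]
            simp [mul_assoc]) (by
            have := congrArg List.length h3
            simp at this hn
            omega)
        exact ⟨l₁, e', hrot.trans h5, h6, h7⟩
      · exfalso
        have hr : IsRed θ (inv t ++ (⟨i, s⁻¹⟩ :: ((⟨j, a⟩ :: m) ++ [⟨i, b * s⟩])) ++ t) := by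
          rw [isRed_append_iff, isRed_append_iff, isRed_cons_iff, isRed_append_iff]
          refine ⟨⟨⟨⟨hz.tail.inv, ?_, ⟨⟨hl4.1.1, isRed_singleton hs⟩, ?_⟩, ?_⟩, ?_⟩,
            hz.tail⟩, ?_⟩
          · rw [inv_mem_iff]; exact hz2.1
          · simpa using hl4.2
          · simpa using hjk.symm
          · simpa using hlast
          · rw [List.cons_append, tags_append, List.getLast?_append, ← List.cons_append, tags_cons,
              tags_append, tags_cons ⟨i, b * s⟩, tags_nil, getLast?_cons_append_singleton]
            simpa using hz2.2.2
        have := tags_conj hθ (c := c) (d := d) hr hl' (by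
          rw [← h]; simp [mul_assoc])
        rw [this] at hc
        refine not_cycTags ?_ (.inl (by simp)) hc
        rw [tags_cons, tags_append, tags_cons ⟨i, b * s⟩, tags_nil,
          getLast?_cons_append_singleton]
        rfl

/-- If an elliptic element has no conjugates, within factors, in the amalgamated subgroup other
than the obvious ones, then it is conjugate to an elliptic or cyclically reduced element only
within a factor. -/
theorem exists_of_conj_elliptic (hθ : ∀ i, Function.Injective (θ i)) {l' : Syl M} {d : H}
    {u z : PushoutI θ} {i : Bool} (hu : u ∈ (PushoutI.of (φ := θ) i).range)
    (hE : ∀ j, u ∈ (PushoutI.of (φ := θ) j).range → ∀ g : M j,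
      (PushoutI.of j g)⁻¹ * u * PushoutI.of j g ∈ (PushoutI.base θ).range → g ∈ (θ j).range)
    (hl' : IsRed θ l') (hc : CycTags l'.tags) (h : z⁻¹ * u * z = PushoutI.base θ d * prod θ l') :
    ∃ j, u ∈ (PushoutI.of (φ := θ) j).range ∧ z ∈ (PushoutI.of (φ := θ) j).range := by
  have hbase : ∀ (c : H) (j : Bool), PushoutI.base θ c ∈ (PushoutI.of (φ := θ) j).range :=
    fun c j => ⟨θ j c, PushoutI.of_apply_eq_base θ j c⟩
  -- Conjugating a syllable outside `C` by a nonempty reduced word that starts in the other factor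
  -- gives a reduced word with equal first and last factors.
  have key : ∀ (t : Syl M) (c : H) (k : Bool) (x : M k), x ∉ (θ k).range → IsRed θ t →
      (∀ y ∈ t.tags.head?, k ≠ y) →
      (prod θ t * PushoutI.base θ c)⁻¹ * PushoutI.of k x * (prod θ t * PushoutI.base θ c) =
        PushoutI.base θ d * prod θ l' → t = [] := by
    intro t c k x hx ht hk he
    by_contra hne
    have hr : IsRed θ (inv t ++ [⟨k, x⟩] ++ t) := by
      rw [isRed_append_iff, isRed_append_iff]
      refine ⟨⟨⟨⟨ht.inv, isRed_singleton hx⟩, ?_⟩, ht⟩, ?_⟩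
      · intro y hy
        rw [tags_inv, List.getLast?_reverse] at hy
        simpa using (hk y hy).symm
      · simpa using hk
    have := tags_conj hθ hr hl' (c := c) (d := d) (by rw [← he]; simp)
    rw [this] at hc
    refine not_cycTags (by simp) (.inr ⟨by simp, ?_⟩) hc
    simpa [tags] using hne
  obtain ⟨lz, c, rfl, hz⟩ := exists_form z
  cases lz with
  | nil => exact ⟨i, hu, by simpa using hbase c i⟩
  | cons s t =>
    obtain ⟨j, s⟩ := s
    have hz2 := isRed_cons_iff.1 hz
    by_cases huj : u ∈ (PushoutI.of (φ := θ) j).range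
    · refine ⟨j, huj, ?_⟩
      obtain ⟨x, hx⟩ := id huj
      -- By `hE` the first syllable of the conjugator cannot move `u` into `C`, so the conjugate by
      -- it is again a syllable and `key` applies to the rest.
      have hxs : s⁻¹ * x * s ∉ (θ j).range := by
        intro hm
        refine hz2.1 (hE j huj s ?_)
        rw [← hx, ← map_inv, ← map_mul, ← map_mul]
        exact (of_mem_base_range hθ).2 hm
      have := key t c j _ hxs hz2.2.1 hz2.2.2 (by
        rw [← h, ← hx]; simp [mul_assoc])
      subst this
      simpa using mul_mem (MonoidHom.mem_range.2 ⟨s, rfl⟩) (hbase c j)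
    · exfalso
      obtain ⟨x, rfl⟩ := hu
      have hij : i ≠ j := by rintro rfl; exact huj ⟨x, rfl⟩
      have hx : x ∉ (θ i).range := by
        rintro ⟨e, rfl⟩
        exact huj (by rw [PushoutI.of_apply_eq_base]; exact hbase e j)
      have := key _ c i x hx hz (by simpa using hij) h
      simp at this

/-- Every element is conjugate to an elliptic or cyclically reduced one. -/
theorem exists_conj_cycTags (l : Syl M) (c : H) (hl : IsRed θ l) :
    ∃ (z : PushoutI θ) (l' : Syl M) (d : H), z⁻¹ * (PushoutI.base θ c * prod θ l) * z =
      PushoutI.base θ d * prod θ l' ∧ IsRed θ l' ∧ CycTags l'.tags := by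
  induction hn : l.length using Nat.strong_induction_on generalizing l c with
  | _ n ih =>
    by_cases hcyc : CycTags l.tags
    · exact ⟨1, l, c, by simp, hl, hcyc⟩
    simp only [CycTags, not_or, not_le, not_not, length_tags] at hcyc
    obtain ⟨h1, h2⟩ := hcyc
    obtain ⟨⟨i, a⟩, t, rfl⟩ := List.exists_cons_of_length_pos (by omega : 0 < l.length)
    rcases List.eq_nil_or_concat t with rfl | ⟨m, ⟨j, b⟩, rfl⟩
    · simp at h1
    simp only [List.concat_eq_append] at *
    have hij : i = j := by
      rw [← List.cons_append, tags_append, List.getLast?_append] at h2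
      simpa using h2
    subst hij
    have hl2 := isRed_cons_iff.1 hl
    have hl3 := isRed_append_iff.1 hl2.2.1
    -- The last syllable moves to the front and merges with `c` and `a`: the length drops by one, or
    -- by two if the merged syllable falls into `C`.
    have hconj : (PushoutI.of i b)⁻¹⁻¹ * (PushoutI.base θ c * prod θ (⟨i, a⟩ :: (m ++ [⟨i, b⟩]))) *
        (PushoutI.of i b)⁻¹ = PushoutI.of i (b * θ i c * a) * prod θ m := by
      simp [mul_assoc, PushoutI.of_apply_eq_base]
    by_cases hm : b * θ i c * a ∈ (θ i).range
    · obtain ⟨e, he⟩ := hm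
      obtain ⟨z, l', d, h5, h6⟩ := ih m.length (by simp at hn; omega) m e hl3.1.1 rfl
      refine ⟨(PushoutI.of i b)⁻¹ * z, l', d, ?_, h6⟩
      rw [← h5, ← PushoutI.of_apply_eq_base θ i e, he, ← hconj]
      group
    · have hne : ∀ y ∈ (tags m).head?, i ≠ y := by
        cases m with
        | nil => simp
        | cons x m => simpa using hl2.2.2
      obtain ⟨z, l', d, h5, h6⟩ := ih (m.length + 1) (by simp at hn; omega)
        (⟨i, b * θ i c * a⟩ :: m) 1 (isRed_cons_iff.2 ⟨hm, hl3.1.1, hne⟩) (by simp)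
      refine ⟨(PushoutI.of i b)⁻¹ * z, l', d, ?_, h6⟩
      rw [← h5]
      rw [prod_cons ⟨i, b * θ i c * a⟩, ← hconj, map_one, one_mul]
      group

end Syl
end Conjugacy

/-! ### Prefixes of reduced words: geometry of the Cayley tree -/

namespace FreeGroup

section Prefix

variable {α : Type*}

/-- In the Cayley tree, cancelling a pair of inverse letters removes a backtrack, so the path of
`L'` visits only vertices visited by `L`. -/
lemma Red.exists_mk_take {L L' : List (α × Bool)} (h : Red L L') (j : ℕ) :
    ∃ k, mk (L.take k) = mk (L'.take j) := by
  induction h generalizing j with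
  | refl => exact ⟨j, rfl⟩
  | tail _ hs ih =>
    suffices ∀ {L L' : List (α × Bool)}, Red.Step L L' → ∀ j, ∃ k,
        mk (L.take k) = mk (L'.take j) by
      obtain ⟨k, hk⟩ := this hs j
      obtain ⟨k', hk'⟩ := ih k
      exact ⟨k', hk'.trans hk⟩
    rintro _ _ ⟨⟩ j
    rename_i L₁ L₂ x b
    rcases le_or_gt j L₁.length with hj | hj
    · exact ⟨j, by rw [List.take_append_of_le_length hj, List.take_append_of_le_length hj]⟩
    · refine ⟨j + 2, ?_⟩
      rw [List.take_append, List.take_append, List.take_of_length_le (l := L₁) (by omega),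
        List.take_of_length_le (l := L₁) (by omega), show j + 2 - L₁.length = (j - L₁.length) + 2 by omega,
        List.take_succ_cons, List.take_succ_cons]
      exact Quot.sound Red.Step.not

variable [DecidableEq α]

/-- The element represented by the prefix of length `j` of the reduced word of `x`. -/
def pre (x : FreeGroup α) (j : ℕ) : FreeGroup α := mk (x.toWord.take j)

lemma exists_mk_take_eq_pre (L : List (α × Bool)) (j : ℕ) : ∃ k, mk (L.take k) = pre (mk L) j := by
  rw [pre, toWord_mk]
  exact reduce.red.exists_mk_take j

lemma norm_mk_of_isReduced {L : List (α × Bool)} (h : IsReduced L) : norm (mk L) = L.length := by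
  rw [norm, toWord_mk, h.reduce_eq]

lemma norm_pre (x : FreeGroup α) (j : ℕ) : norm (pre x j) = min j (norm x) := by
  rw [pre, norm_mk_of_isReduced (isReduced_toWord.infix (List.take_prefix _ _).isInfix),
    List.length_take, norm]

@[simp] lemma pre_zero (x : FreeGroup α) : pre x 0 = 1 := by simp [pre, one_eq_mk]

@[simp] lemma pre_norm (x : FreeGroup α) : pre x (norm x) = x := by
  simp [pre, norm, mk_toWord]

lemma pre_of_norm_le (x : FreeGroup α) {j : ℕ} (h : norm x ≤ j) : pre x j = x := by
  rw [pre, List.take_of_length_le h, mk_toWord]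

lemma inv_pre_mul_pre (x : FreeGroup α) {i j : ℕ} (h : i ≤ j) :
    (pre x i)⁻¹ * pre x j = mk ((x.toWord.take j).drop i) := by
  rw [inv_mul_eq_iff_eq_mul, pre, pre, mul_mk]
  conv_lhs => rw [← List.take_append_drop i (x.toWord.take j)]
  rw [List.take_take, min_eq_left h]

lemma norm_inv_pre_mul_pre (x : FreeGroup α) {i j : ℕ} (h : i ≤ j) (hj : j ≤ norm x) :
    norm ((pre x i)⁻¹ * pre x j) = j - i := by
  rw [inv_pre_mul_pre x h, norm_mk_of_isReduced]
  · simp only [List.length_drop, List.length_take]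
    rw [norm] at hj
    omega
  · exact isReduced_toWord.infix
      ((List.drop_suffix _ _).isInfix.trans (List.take_prefix _ _).isInfix)

lemma norm_inv_pre_mul (x : FreeGroup α) {i : ℕ} (h : i ≤ norm x) :
    norm ((pre x i)⁻¹ * x) = norm x - i := by
  have := norm_inv_pre_mul_pre x h le_rfl
  rwa [pre_norm] at this

lemma norm_inv_pre_mul_pre_succ_le (x : FreeGroup α) (i : ℕ) :
    norm ((pre x i)⁻¹ * pre x (i + 1)) ≤ 1 := by
  rw [inv_pre_mul_pre x (Nat.le_succ i)]
  refine norm_mk_le.trans ?_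
  simp only [List.length_drop, List.length_take]
  omega

lemma norm_inv_mul_comm (x y : FreeGroup α) : norm (x⁻¹ * y) = norm (y⁻¹ * x) := by
  rw [← norm_inv_eq]
  simp

lemma norm_inv_mul_le (x y z : FreeGroup α) :
    norm (x⁻¹ * z) ≤ norm (x⁻¹ * y) + norm (y⁻¹ * z) := by
  have := norm_mul_le (x⁻¹ * y) (y⁻¹ * z)
  simpa [mul_assoc] using this

/-- A path with steps of length at most `M` passes within `M` of every prefix of its end point. -/
lemma exists_near_pre (w : ℕ → FreeGroup α) (h0 : w 0 = 1) {M : ℕ} (n : ℕ)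
    (hw : ∀ i < n, norm ((w i)⁻¹ * w (i + 1)) ≤ M) (j : ℕ) :
    ∃ i ≤ n, norm ((pre (w n) j)⁻¹ * w i) ≤ M := by
  suffices ∃ L, mk L = w n ∧ ∀ k, ∃ i ≤ n, norm ((mk (L.take k))⁻¹ * w i) ≤ M by
    obtain ⟨L, hL, h⟩ := this
    obtain ⟨k, hk⟩ := exists_mk_take_eq_pre L j
    rw [← hL, ← hk]
    exact h k
  induction n with
  | zero => exact ⟨[], by simp [h0, one_eq_mk], fun k => ⟨0, le_rfl, by simp [h0, ← one_eq_mk]⟩⟩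
  | succ n ih =>
    obtain ⟨L, hL, h⟩ := ih fun i hi => hw i (by omega)
    -- `L` spells the path with every step replaced by its geodesic, so each prefix of `L` ends
    -- within `M` of some `w i`.
    refine ⟨L ++ ((w n)⁻¹ * w (n + 1)).toWord, ?_, fun k => ?_⟩
    · rw [← mul_mk, mk_toWord, hL]
      group
    · rcases le_or_gt k L.length with hk | hk
      · obtain ⟨i, hi, hi'⟩ := h k
        exact ⟨i, by omega, by rwa [List.take_append_of_le_length hk]⟩
      · refine ⟨n, by omega, ?_⟩
        rw [List.take_append, List.take_of_length_le hk.le, ← mul_mk, hL, mul_inv_rev, mul_assoc,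
          inv_mul_cancel, mul_one, norm_inv_eq]
        exact (norm_mk_le.trans (List.length_take_le' _ _)).trans (hw n (by omega))

/-- The prefixes of `c` are close to the translates by `g` of the prefixes of `g⁻¹ c h`. -/
lemma exists_near_pre_mul (g h c : FreeGroup α) (j : ℕ) :
    ∃ i, norm ((pre c j)⁻¹ * g * pre (g⁻¹ * c * h) i) ≤ max (norm g) (norm h) := by
  set d := g⁻¹ * c * h with hd
  -- The path through `1`, `g`, `g * d`, `c` visits every prefix of `c`; vertices on its first and
  -- last sides are within `norm g` or `norm h` of an end of the middle side.
  have hc : c = mk (g.toWord ++ (d.toWord ++ h⁻¹.toWord)) := by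
    rw [← mul_mk, ← mul_mk, mk_toWord, mk_toWord, mk_toWord, hd]
    group
  obtain ⟨k, hk⟩ := exists_mk_take_eq_pre (g.toWord ++ (d.toWord ++ h⁻¹.toWord)) j
  rw [← hc] at hk
  rw [← hk]
  rcases le_or_gt k g.toWord.length with h1 | h1
  · refine ⟨0, le_max_of_le_left ?_⟩
    rw [List.take_append_of_le_length h1, pre_zero, mul_one]
    change norm ((pre g k)⁻¹ * g) ≤ _
    rw [norm_inv_pre_mul g h1]
    omega
  · rw [List.take_append, List.take_of_length_le h1.le, ← mul_mk, mk_toWord, mul_inv_rev,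
      inv_mul_cancel_right]
    rcases le_or_gt (k - g.toWord.length) d.toWord.length with h2 | h2
    · refine ⟨k - g.toWord.length, ?_⟩
      rw [List.take_append_of_le_length h2, pre, inv_mul_cancel, norm_one]
      exact Nat.zero_le _
    · refine ⟨norm d, le_max_of_le_right ?_⟩
      rw [List.take_append, List.take_of_length_le h2.le, ← mul_mk, mk_toWord, mul_inv_rev,
        pre_norm, inv_mul_cancel_right, norm_inv_eq]
      refine norm_mk_le.trans ((List.length_take_le' _ _).trans ?_)
      change norm h⁻¹ ≤ _
      rw [norm_inv_eq]

/-- `j` counts the cancelled letters: a letter of `L` either removes the last letter of `g`, or the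
words concatenate without cancellation from there on. -/
lemma exists_cancel_mk (L : List (α × Bool)) (hL : IsReduced L) (g : FreeGroup α) :
    ∃ j ≤ L.length, norm (g * mk (L.take j)) + j = norm g ∧
      norm (g * mk L) + 2 * j = norm g + L.length := by
  induction L generalizing g with
  | nil => exact ⟨0, by simp [← one_eq_mk]⟩
  | cons x L ih =>
    by_cases hx : ∃ G, g.toWord = G ++ [(x.1, !x.2)]
    · obtain ⟨G, hG⟩ := hx
      have hg : g = mk (G ++ [(x.1, !x.2)]) := by rw [← hG, mk_toWord]
      have hgx : g * mk [x] = mk G := by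
        rw [hg, ← mul_mk, mul_assoc, mul_mk]
        have : mk ([(x.1, !x.2)] ++ [x]) = 1 := Quot.sound Red.Step.cons_not_rev
        rw [this, mul_one]
      have hGr : IsReduced G := by
        have := isReduced_toWord (x := g)
        rw [hG] at this
        exact this.infix (List.prefix_append _ _).isInfix
      have hn : norm g = G.length + 1 := by rw [norm, hG]; simp
      obtain ⟨j, hj, h1, h2⟩ := ih (hL.infix (List.suffix_cons _ _).isInfix) (g * mk [x])
      have hn' : norm (g * mk [x]) = G.length := by rw [hgx, norm_mk_of_isReduced hGr]
      refine ⟨j + 1, by simpa using hj, ?_, ?_⟩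
      · rw [mul_assoc, mul_mk] at h1
        rw [List.take_succ_cons]
        simp only [List.singleton_append] at h1
        omega
      · rw [mul_assoc, mul_mk] at h2
        simp only [List.singleton_append, List.length_cons] at h2 ⊢
        omega
    · refine ⟨0, Nat.zero_le _, by simp [← one_eq_mk], ?_⟩
      have : IsReduced (g.toWord ++ x :: L) := by
        rw [IsReduced, List.isChain_append]
        refine ⟨isReduced_toWord, hL, ?_⟩
        intro y hy z hz hyz
        simp only [List.head?_cons, Option.mem_def, Option.some.injEq] at hz
        subst hz
        by_contra hne
        obtain ⟨G, hG⟩ := List.getLast?_eq_some_iff.1 hy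
        refine hx ⟨G, ?_⟩
        rw [hG]
        congr 2
        ext
        · exact hyz
        · simp only
          revert hne
          cases y.2 <;> cases x.2 <;> simp
      have h3 : g * mk (x :: L) = mk (g.toWord ++ x :: L) := by rw [← mul_mk, mk_toWord]
      rw [h3, norm_mk_of_isReduced this]
      simp [norm]

/-- The cancellation in the product `g * c`. -/
lemma exists_cancel (g c : FreeGroup α) : ∃ j ≤ norm c, norm (g * pre c j) + j = norm g ∧
    norm (g * c) + 2 * j = norm g + norm c := by
  have := exists_cancel_mk c.toWord isReduced_toWord g
  rwa [mk_toWord] at this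

end Prefix

end FreeGroup

/-! ### Finitely generated subgroups: quasiconvexity and distortion -/

namespace FreeGroup

section Quasiconvex

variable {α β ρ : Type*} [DecidableEq α] [DecidableEq β] [DecidableEq ρ]
  {C : Type*} [Group C]

lemma finite_norm_le [Finite α] (n : ℕ) : {x : FreeGroup α | norm x ≤ n}.Finite :=
  Set.Finite.preimage toWord_injective.injOn (List.finite_length_le (α × Bool) n)

lemma exists_norm_map_le [Finite ρ] (f : FreeGroup ρ →* FreeGroup β) :
    ∃ D, ∀ z, norm (f z) ≤ D * norm z := by
  obtain ⟨D, hD⟩ := (Set.finite_range fun a => norm (f (of a))).bddAbove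
  have hD' : ∀ a, norm (f (of a)) ≤ D := fun a => hD ⟨a, rfl⟩
  suffices ∀ L : List (ρ × Bool), norm (f (mk L)) ≤ D * L.length by
    refine ⟨D, fun z => ?_⟩
    have := this z.toWord
    rwa [mk_toWord] at this
  intro L
  induction L with
  | nil => simp [← one_eq_mk]
  | cons x L ih =>
    have h1 : norm (f (mk [x])) ≤ D := by
      obtain ⟨a, b⟩ := x
      cases b with
      | true => exact hD' a
      | false =>
        have : mk [(a, false)] = (of a)⁻¹ := by simp [of, invRev]
        rw [this, _root_.map_inv, norm_inv_eq]
        exact hD' a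
    rw [show x :: L = [x] ++ L from rfl, ← mul_mk, _root_.map_mul]
    have := norm_mul_le (f (mk [x])) (f (mk L))
    simp only [List.length_append, List.length_singleton]
    linarith [Nat.mul_add D 1 L.length]

/-- Finitely generated subgroups of free groups are quasiconvex. -/
lemma exists_quasiconvex [Finite ρ] {η : FreeGroup ρ →* C} (hη : Function.Surjective η)
    (φ : C →* FreeGroup α) :
    ∃ K, ∀ c j, ∃ y, norm ((pre (φ c) j)⁻¹ * φ y) ≤ K := by
  obtain ⟨D, hD⟩ := exists_norm_map_le (φ.comp η)
  refine ⟨D, fun c j => ?_⟩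
  obtain ⟨z, rfl⟩ := hη c
  -- The image of a geodesic of `FreeGroup ρ` is a path inside the subgroup with steps of length at
  -- most `D`.
  obtain ⟨i, -, hi⟩ := exists_near_pre (fun i => φ (η (pre z i))) (by simp) (M := D) (norm z)
    (fun i _ => by
      rw [← _root_.map_inv, ← _root_.map_inv, ← _root_.map_mul, ← _root_.map_mul]
      refine (hD _).trans ?_
      have := Nat.mul_le_mul_left D (norm_inv_pre_mul_pre_succ_le z i)
      simpa using this) j
  rw [pre_norm] at hi
  exact ⟨_, hi⟩

/-- `φ y` is within `K` of the geodesic from `1` to `φ c`. -/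
def Near (φ : C →* FreeGroup α) (K : ℕ) (y c : C) : Prop :=
  ∃ j, norm ((pre (φ c) j)⁻¹ * φ y) ≤ K

lemma Near.mono {φ : C →* FreeGroup α} {K K' : ℕ} (h : K ≤ K') {y c : C} (hy : Near φ K y c) :
    Near φ K' y c := hy.imp fun _ hj => hj.trans h

/-- A chain of elements of `C` along the geodesic from `1` to `φ c`. -/
def IsChainTo (φ : C →* FreeGroup α) (K : ℕ) (c : C) (y : ℕ → C) : Prop :=
  y 0 = 1 ∧ y (norm (φ c)) = c ∧ ∀ j, norm ((pre (φ c) j)⁻¹ * φ (y j)) ≤ K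

/-- Quasiconvexity gives the points; those at the two ends are overridden, because a nearby point
need not be exactly `1` or `c`. -/
lemma exists_chain [Finite ρ] {η : FreeGroup ρ →* C} (hη : Function.Surjective η)
    (φ : C →* FreeGroup α) (hφ : Function.Injective φ) :
    ∃ K, ∀ c, ∃ y, IsChainTo φ K c y := by
  obtain ⟨K, hK⟩ := exists_quasiconvex hη φ
  refine ⟨K, fun c => ?_⟩
  choose y hy using hK c
  refine ⟨fun j => if j = 0 then 1 else if norm (φ c) ≤ j then c else y j, by simp, ?_, fun j => ?_⟩
  · by_cases h : norm (φ c) = 0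
    · beta_reduce
      rw [if_pos h]
      refine (hφ ?_).symm
      rw [norm_eq_zero.1 h, _root_.map_one]
    · beta_reduce
      rw [if_neg h, if_pos le_rfl]
  · simp only
    split_ifs with h1 h2
    · simp [h1]
    · simp [pre_of_norm_le _ h2]
    · exact hy j

lemma IsChainTo.jump {φ : C →* FreeGroup α} {K : ℕ} {c : C} {y : ℕ → C} (h : IsChainTo φ K c y)
    (j : ℕ) : norm (φ ((y j)⁻¹ * y (j + 1))) ≤ 2 * K + 1 := by
  have h1 := h.2.2 j
  have h2 := h.2.2 (j + 1)
  have h3 := norm_inv_pre_mul_pre_succ_le (φ c) j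
  have h4 := norm_inv_mul_le (φ (y j)) (pre (φ c) j) (φ (y (j + 1)))
  have h5 := norm_inv_mul_le (pre (φ c) j) (pre (φ c) (j + 1)) (φ (y (j + 1)))
  rw [norm_inv_mul_comm (φ (y j)) (pre (φ c) j)] at h4
  rw [_root_.map_mul, _root_.map_inv]
  omega

/-- Finitely generated subgroups of free groups are undistorted. -/
lemma exists_preimage_norm_le [Finite α] [Finite ρ] {η : FreeGroup ρ →* C}
    (hη : Function.Surjective η) (φ : C →* FreeGroup α) (hφ : Function.Injective φ) :
    ∃ K, ∀ c, ∃ z, η z = c ∧ norm z ≤ K * norm (φ c) := by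
  obtain ⟨K, hK⟩ := exists_chain hη φ hφ
  -- Consecutive points of a chain differ by one of finitely many elements of `C`, so their chosen
  -- preimages have bounded length.
  have hfin : {c : C | norm (φ c) ≤ 2 * K + 1}.Finite :=
    (finite_norm_le (2 * K + 1)).preimage hφ.injOn
  choose s hs using hη
  obtain ⟨D, hD⟩ := (hfin.image fun c => norm (s c)).bddAbove
  refine ⟨D, fun c => ?_⟩
  obtain ⟨y, hy⟩ := hK c
  have : ∀ j, ∃ z, η z = y j ∧ norm z ≤ D * j := by
    intro j
    induction j with
    | zero => exact ⟨1, by simp [hy.1], by simp⟩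
    | succ j ih =>
      obtain ⟨z, h1, h2⟩ := ih
      refine ⟨z * s ((y j)⁻¹ * y (j + 1)), by simp [hs, h1], ?_⟩
      have h3 := norm_mul_le z (s ((y j)⁻¹ * y (j + 1)))
      have h4 : norm (s ((y j)⁻¹ * y (j + 1))) ≤ D := hD ⟨_, hy.jump j, rfl⟩
      linarith [Nat.mul_succ D j]
  obtain ⟨z, h1, h2⟩ := this (norm (φ c))
  exact ⟨z, by rw [h1, hy.2.1], h2⟩

/-- A preimage in `FreeGroup ρ` that is short compared with `φ c` has a short image under `ψ`. Hence
the two embeddings give comparable lengths on `C`. -/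
lemma exists_norm_le_norm [Finite α] [Finite ρ] {η : FreeGroup ρ →* C}
    (hη : Function.Surjective η) (φ : C →* FreeGroup α) (hφ : Function.Injective φ)
    (ψ : C →* FreeGroup β) : ∃ K, ∀ c, norm (ψ c) ≤ K * norm (φ c) := by
  obtain ⟨K, hK⟩ := exists_preimage_norm_le hη φ hφ
  obtain ⟨D, hD⟩ := exists_norm_map_le (ψ.comp η)
  refine ⟨D * K, fun c => ?_⟩
  obtain ⟨z, rfl, hz⟩ := hK c
  refine (hD z).trans ?_
  rw [mul_assoc]
  exact Nat.mul_le_mul_left D hz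

/-- Being near to geodesics does not depend on the embedding of `C` in a free group. -/
lemma exists_near_of_near [Finite α] [Finite β] [Finite ρ] {η : FreeGroup ρ →* C}
    (hη : Function.Surjective η) {φ : C →* FreeGroup α} (hφ : Function.Injective φ)
    {ψ : C →* FreeGroup β} (hψ : Function.Injective ψ) (N : ℕ) :
    ∃ N', ∀ x c, Near φ N x c → Near ψ N' x c := by
  obtain ⟨K, hK⟩ := exists_chain hη ψ hψ
  obtain ⟨D, hD⟩ := exists_norm_le_norm hη ψ hψ φ
  obtain ⟨E, hE⟩ := exists_norm_le_norm hη φ hφ ψ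
  refine ⟨K + E * (N + D * (2 * K + 1)), fun x c => ?_⟩
  rintro ⟨j, hj⟩
  obtain ⟨y, hy⟩ := hK c
  -- Seen through `φ`, the chain along the `ψ`-geodesic is a path with bounded steps to `φ c`, so it
  -- passes close to the vertex near `φ x`; `E` converts the distance back to `ψ`.
  obtain ⟨i, -, hi⟩ := exists_near_pre (fun i => φ (y i)) (by simp [hy.1])
    (M := D * (2 * K + 1)) (norm (ψ c)) (fun i _ => by
      rw [← _root_.map_inv, ← _root_.map_mul]
      exact (hD _).trans (Nat.mul_le_mul_left D (hy.jump i))) j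
  rw [hy.2.1] at hi
  refine ⟨i, ?_⟩
  have h1 := norm_inv_mul_le (φ (y i)) (pre (φ c) j) (φ x)
  rw [norm_inv_mul_comm (φ (y i)) (pre (φ c) j)] at h1
  have h2 := hE ((y i)⁻¹ * x)
  rw [_root_.map_mul, _root_.map_inv, _root_.map_mul, _root_.map_inv] at h2
  have h3 := norm_inv_mul_le (pre (ψ c) i) (ψ (y i)) (ψ x)
  have h4 := hy.2.2 i
  have h5 : E * norm ((φ (y i))⁻¹ * φ x) ≤ E * (N + D * (2 * K + 1)) :=
    Nat.mul_le_mul_left E (by omega)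
  omega

/-- Carries a point of `C` across a syllable: the translate by `g` of the geodesic to `φ d` passes
close to every vertex of the geodesic to `φ c`, and quasiconvexity replaces the vertex found there
by a point of `C`. -/
lemma exists_near_transport {φ : C →* FreeGroup α} {K : ℕ}
    (hK : ∀ c j, ∃ y, norm ((pre (φ c) j)⁻¹ * φ y) ≤ K) {N : ℕ} {g h : FreeGroup α} {c d x : C}
    (hd : φ d = g⁻¹ * φ c * h) (hx : Near φ N x c) :
    ∃ y, Near φ K y d ∧ norm ((φ x)⁻¹ * g * φ y) ≤ N + max (norm g) (norm h) + K := by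
  obtain ⟨j, hj⟩ := hx
  obtain ⟨i, hi⟩ := exists_near_pre_mul g h (φ c) j
  rw [← hd] at hi
  obtain ⟨y, hy⟩ := hK d i
  refine ⟨y, ⟨i, hy⟩, ?_⟩
  have h1 := norm_mul_le ((φ x)⁻¹ * pre (φ c) j) ((pre (φ c) j)⁻¹ * g * pre (φ d) i)
  have h2 := norm_mul_le ((φ x)⁻¹ * g * pre (φ d) i) ((pre (φ d) i)⁻¹ * φ y)
  rw [norm_inv_mul_comm] at h1
  have e1 : (φ x)⁻¹ * pre (φ c) j * ((pre (φ c) j)⁻¹ * g * pre (φ d) i) =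
    (φ x)⁻¹ * g * pre (φ d) i := by group
  have e2 : (φ x)⁻¹ * g * pre (φ d) i * ((pre (φ d) i)⁻¹ * φ y) = (φ x)⁻¹ * g * φ y := by group
  rw [e1] at h1
  rw [e2] at h2
  omega

end Quasiconvex

end FreeGroup

/-! ### Counting short words -/

section Count

/-- The number of words of length at most `k` over an alphabet of `s` letters. -/
def numWords (s : ℕ) : ℕ → ℕ
  | 0 => 1
  | k + 1 => 1 + s * numWords s k

lemma numWords_mono_left {s t : ℕ} (h : s ≤ t) (k : ℕ) : numWords s k ≤ numWords t k := by
  induction k with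
  | zero => exact le_rfl
  | succ k ih => exact Nat.add_le_add_left (Nat.mul_le_mul h ih) 1

lemma numWords_mono (s : ℕ) (hs : 1 ≤ s) : Monotone (numWords s) := by
  refine monotone_nat_of_le_succ fun k => ?_
  have := Nat.mul_le_mul_right (numWords s k) hs
  rw [numWords]
  omega

lemma one_le_numWords (s k : ℕ) : 1 ≤ numWords s k := by
  cases k with
  | zero => exact le_rfl
  | succ k => exact Nat.le_add_right _ _

/-- All words of length at most `k` over a list of letters. -/
def wordsLE {α : Type*} (letters : List α) : ℕ → List (List α)
  | 0 => [[]]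
  | k + 1 => [] :: (wordsLE letters k).flatMap fun w => letters.map (· :: w)

lemma mem_wordsLE {α : Type*} {letters : List α} (h : ∀ a, a ∈ letters) {k : ℕ} {w : List α} :
    w ∈ wordsLE letters k ↔ w.length ≤ k := by
  induction k generalizing w with
  | zero => simp [wordsLE]
  | succ k ih =>
    cases w with
    | nil => simp [wordsLE]
    | cons a w => simp [wordsLE, ih, h]

lemma length_wordsLE {α : Type*} (letters : List α) (k : ℕ) :
    (wordsLE letters k).length = numWords letters.length k := by
  induction k with
  | zero => rfl
  | succ k ih =>
    simp only [wordsLE, List.length_cons, List.length_flatMap, List.length_map,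
      List.map_const', List.sum_replicate, smul_eq_mul, ih, numWords]
    ring

/-- The pigeonhole principle for pairs of short words. -/
lemma exists_lt_eq_of_length_le {α β : Type*} [Fintype α] [Fintype β] {k l J : ℕ}
    (f : ℕ → List α) (g : ℕ → List β) (hf : ∀ j ≤ J, (f j).length ≤ k)
    (hg : ∀ j ≤ J, (g j).length ≤ l)
    (hJ : numWords (Fintype.card α) k * numWords (Fintype.card β) l ≤ J) :
    ∃ i j, i < j ∧ j ≤ J ∧ f i = f j ∧ g i = g j := by
  classical
  have hA : ∀ a : α, a ∈ (Finset.univ : Finset α).toList := by simp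
  have hB : ∀ a : β, a ∈ (Finset.univ : Finset β).toList := by simp
  let S := (wordsLE (Finset.univ : Finset α).toList k).toFinset ×ˢ
    (wordsLE (Finset.univ : Finset β).toList l).toFinset
  have hS : S.card ≤ J := by
    rw [Finset.card_product]
    refine (Nat.mul_le_mul (List.toFinset_card_le _) (List.toFinset_card_le _)).trans ?_
    simpa [length_wordsLE] using hJ
  obtain ⟨i, hi, j, hj, hne, he⟩ := Finset.exists_ne_map_eq_of_card_lt_of_maps_to
    (s := Finset.range (J + 1)) (t := S) (f := fun j => (f j, g j)) (by simpa using by omega) (by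
      intro j hj
      have hj' : j ≤ J := by simpa [Nat.lt_succ_iff] using hj
      simp only [S, Finset.coe_product, Set.mem_prod, Finset.mem_coe, List.mem_toFinset,
        mem_wordsLE hA, mem_wordsLE hB]
      exact ⟨hf j hj', hg j hj'⟩)
  simp only [Finset.mem_range, Prod.mk.injEq] at hi hj he
  rcases lt_or_gt_of_ne hne with h | h
  · exact ⟨i, j, h, by omega, he⟩
  · exact ⟨j, i, h, by omega, he.1.symm, he.2.symm⟩

end Count

/-! ### Pumping conjugators in a free group -/

namespace FreeGroup

section Pump

variable {α : Type*} [DecidableEq α] {C : Type*} [Group C]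

/-- Cuts out the stretch between positions `i` and `j`. Since `2 * j ≤ norm z`, the end `(pre z j)⁻¹
* z` is longer than `pre z i` and cannot cancel it, so the result is not trivial. -/
lemma norm_pump (z : FreeGroup α) {i j : ℕ} (hij : i < j) (hj : 2 * j ≤ norm z) :
    norm (pre z i * (pre z j)⁻¹) < norm z ∧ norm (pre z j * (pre z i)⁻¹) < norm z ∧
      norm (pre z i * (pre z j)⁻¹ * z) < norm z ∧ pre z i * (pre z j)⁻¹ * z ≠ 1 := by
  have h1 := norm_pre z i
  have h2 := norm_pre z j
  have h3 := norm_inv_pre_mul z (i := j) (by omega)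
  have h4 := norm_mul_le (pre z i) (pre z j)⁻¹
  have h4' := norm_mul_le (pre z j) (pre z i)⁻¹
  rw [norm_inv_eq] at h4 h4'
  have h5 := norm_mul_le (pre z i) ((pre z j)⁻¹ * z)
  rw [← mul_assoc] at h5
  refine ⟨by omega, by omega, by omega, fun h => ?_⟩
  rw [mul_assoc, mul_eq_one_iff_inv_eq] at h
  have h6 := congrArg norm h
  rw [norm_inv_eq] at h6
  omega

/-- The displacement of an element along the geodesic to a conjugator. -/
lemma norm_conj_pre_le (u z : FreeGroup α) (j : ℕ) :
    norm ((pre z j)⁻¹ * u * pre z j) ≤ 3 * (norm u + norm (z⁻¹ * u * z)) := by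
  -- As `u⁻¹ * z * (z⁻¹ * u * z) = z`, translation by `u` keeps the geodesic to `z` close to itself.
  obtain ⟨i, hi⟩ := exists_near_pre_mul u (z⁻¹ * u * z) z j
  rw [show u⁻¹ * z * (z⁻¹ * u * z) = z by group] at hi
  wlog hij : i ≤ norm z generalizing i
  · rw [pre_of_norm_le z (not_le.1 hij).le] at hi
    exact this (norm z) (by rwa [pre_norm]) le_rfl
  wlog hj : j ≤ norm z generalizing j
  · rw [pre_of_norm_le z (not_le.1 hj).le] at hi ⊢
    have := this (norm z) (by rwa [pre_norm]) le_rfl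
    rwa [pre_norm] at this
  have hL : max (norm u) (norm (z⁻¹ * u * z)) ≤ norm u + norm (z⁻¹ * u * z) := by omega
  have hpi := norm_pre z i
  have hpj := norm_pre z j
  -- Comparing the lengths of `u * pre z i` and `pre z j` bounds the shift between `i` and `j`.
  have e1 := norm_mul_le (u⁻¹ * pre z j) ((pre z j)⁻¹ * u * pre z i)
  have e2 := norm_mul_le u⁻¹ (pre z j)
  have e3 := norm_mul_le (u * pre z i) ((pre z j)⁻¹ * u * pre z i)⁻¹
  have e4 := norm_mul_le u (pre z i)
  rw [show u⁻¹ * pre z j * ((pre z j)⁻¹ * u * pre z i) = pre z i by group] at e1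
  rw [show u * pre z i * ((pre z j)⁻¹ * u * pre z i)⁻¹ = pre z j by group, norm_inv_eq] at e3
  rw [norm_inv_eq] at e2
  have e5 := norm_mul_le ((pre z j)⁻¹ * u * pre z i) ((pre z i)⁻¹ * pre z j)
  rw [show (pre z j)⁻¹ * u * pre z i * ((pre z i)⁻¹ * pre z j) = (pre z j)⁻¹ * u * pre z j by group]
    at e5
  have e6 : norm ((pre z i)⁻¹ * pre z j) ≤ (j - i) + (i - j) := by
    rcases le_total i j with h | h
    · rw [norm_inv_pre_mul_pre z h hj]
      omega
    · rw [norm_inv_mul_comm, norm_inv_pre_mul_pre z h hij]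
      omega
  omega

/-- A long conjugator is the product of an element of the centralizer and a conjugator,
both of which are shorter. -/
lemma exists_conj_pump [Fintype α] (u z : FreeGroup α)
    (hz : 2 * numWords (Fintype.card (α × Bool)) (3 * (norm u + norm (z⁻¹ * u * z))) ≤ norm z) :
    ∃ w z', z = w * z' ∧ w⁻¹ * u * w = u ∧ norm w < norm z ∧ norm z' < norm z ∧
      z'⁻¹ * u * z' = z⁻¹ * u * z := by
  -- The conjugate of `u` by `pre z j` takes boundedly many values, so it repeats. The second
  -- pigeonhole coordinate is trivial here.
  obtain ⟨i, j, hij, hj, h, -⟩ := exists_lt_eq_of_length_le (β := Empty)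
    (J := numWords (Fintype.card (α × Bool)) (3 * (norm u + norm (z⁻¹ * u * z)))) (l := 0)
    (fun j => ((pre z j)⁻¹ * u * pre z j).toWord) (fun _ => [])
    (fun j _ => norm_conj_pre_le u z j) (by simp) (by simp [numWords])
  rw [toWord_inj] at h
  obtain ⟨h1, h2, h3, h4⟩ := norm_pump z hij (by omega)
  refine ⟨pre z j * (pre z i)⁻¹, pre z i * (pre z j)⁻¹ * z, by group, ?_, h2, h3, ?_⟩
  · have : (pre z j * (pre z i)⁻¹)⁻¹ * u * (pre z j * (pre z i)⁻¹) =
      pre z i * ((pre z j)⁻¹ * u * pre z j) * (pre z i)⁻¹ := by group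
    rw [this, ← h]
    group
  · have : (pre z i * (pre z j)⁻¹ * z)⁻¹ * u * (pre z i * (pre z j)⁻¹ * z) =
      z⁻¹ * pre z j * ((pre z i)⁻¹ * u * pre z i) * (pre z j)⁻¹ * z := by group
    rw [this, h]
    group

/-- Conjugate elements of a free group are conjugate by a short element. -/
lemma exists_short_conj [Fintype α] {u v z : FreeGroup α} (h : z⁻¹ * u * z = v) :
    ∃ z', z'⁻¹ * u * z' = v ∧
      norm z' ≤ 2 * numWords (Fintype.card (α × Bool)) (3 * (norm u + norm v)) := by
  induction hn : norm z using Nat.strong_induction_on generalizing z with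
  | _ n ih =>
    rcases le_total (norm z)
      (2 * numWords (Fintype.card (α × Bool)) (3 * (norm u + norm v))) with h1 | h1
    · exact ⟨z, h, h1⟩
    · obtain ⟨w, z', -, -, -, h2, h3⟩ := exists_conj_pump u z (by rwa [h])
      exact ih _ (hn ▸ h2) (h3.trans h) rfl

/-- It is enough to check on short elements that all elements which conjugate `u` into the
subgroup `C` lie in `C`. -/
lemma mem_range_of_conj_mem_range [Fintype α] {φ : C →* FreeGroup α} {K : ℕ}
    (hK : ∀ c j, ∃ y, norm ((pre (φ c) j)⁻¹ * φ y) ≤ K) (u : FreeGroup α)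
    (hu : ∀ g, norm g ≤ 2 * numWords (Fintype.card (α × Bool)) (3 * (2 * norm u + 2 * K)) →
      g⁻¹ * u * g ∈ φ.range → g ∈ φ.range) (g : FreeGroup α) (hg : g⁻¹ * u * g ∈ φ.range) :
    g ∈ φ.range := by
  induction hn : norm g using Nat.strong_induction_on generalizing g with
  | _ n ih =>
    -- Right multiplication by `φ c` affects neither hypothesis nor conclusion, so `g` may be taken
    -- shortest in its coset.
    by_cases hmin : ∃ c, norm (g * φ c) < norm g
    · obtain ⟨c, hc⟩ := hmin
      have hc' : φ c ∈ φ.range := ⟨c, rfl⟩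
      have := ih _ (hn ▸ hc) (g * φ c) (by
        have : (g * φ c)⁻¹ * u * (g * φ c) = (φ c)⁻¹ * (g⁻¹ * u * g) * φ c := by group
        rw [this]
        exact mul_mem (mul_mem (inv_mem hc') hg) hc') rfl
      exact (Subgroup.mul_mem_cancel_right _ hc').1 this
    push Not at hmin
    obtain ⟨c, hc⟩ := id hg
    -- At most `K` letters cancel in `g * φ c = u * g`: a point of the subgroup near the cancelled
    -- prefix of `φ c` would otherwise shorten `g` within its coset.
    have hcn : norm (g⁻¹ * u * g) ≤ norm u + 2 * K := by
      rw [← hc]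
      obtain ⟨j, hj, h1, h2⟩ := exists_cancel g (φ c)
      obtain ⟨y, hy⟩ := hK c j
      have h3 := hmin y
      have h4 := norm_mul_le (g * pre (φ c) j) ((pre (φ c) j)⁻¹ * φ y)
      rw [show g * pre (φ c) j * ((pre (φ c) j)⁻¹ * φ y) = g * φ y by group] at h4
      have h5 := norm_mul_le u g
      rw [show u * g = g * φ c by rw [hc]; group] at h5
      omega
    by_cases hs : norm g ≤ 2 * numWords (Fintype.card (α × Bool)) (3 * (2 * norm u + 2 * K))
    · exact hu g hs hg
    · have hmon : numWords (Fintype.card (α × Bool)) (3 * (norm u + norm (g⁻¹ * u * g))) ≤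
          numWords (Fintype.card (α × Bool)) (3 * (2 * norm u + 2 * K)) := by
        by_cases h0 : Fintype.card (α × Bool) = 0
        · have : norm g = 0 := by
            have := Fintype.card_eq_zero_iff.1 h0
            rw [norm, List.length_eq_zero_iff]
            exact List.eq_nil_iff_forall_not_mem.2 fun a _ => this.elim a
          omega
        · exact numWords_mono _ (by omega) (by omega)
      -- `z` conjugates `u` as `g` does, so `z` lies in the subgroup by induction; hence so does
      -- `u`, and then `w`, which centralizes `u`.
      obtain ⟨w, z, rfl, h1, h2, h3, h4⟩ := exists_conj_pump u g (by omega)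
      have hz : z ∈ φ.range := ih _ (hn ▸ h3) z (by rwa [h4]) rfl
      have huC : u ∈ φ.range := by
        have : u = z * (z⁻¹ * u * z) * z⁻¹ := by group
        rw [this, h4]
        exact mul_mem (mul_mem hz hg) (inv_mem hz)
      exact mul_mem (ih _ (hn ▸ h2) w (by rwa [h1]) rfl) hz

end Pump

end FreeGroup

/-! ### Pumping elements of `C` in the amalgamated product -/

section MainConj

open Syl

variable {m n : ℕ} {C : Type*} [Group C]
  {φ : C →* FreeGroup (Fin m)} {ψ : C →* FreeGroup (Fin n)}

/-- The factors of the amalgamated product of two free groups. -/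
abbrev FreeFactor (m n : ℕ) : Bool → Type := Factor (FreeGroup (Fin m)) (FreeGroup (Fin n))

/-- The length of an element of a factor. -/
def factorLen : ∀ i, FreeFactor m n i → ℕ
  | false => FreeGroup.norm (α := Fin m)
  | true => FreeGroup.norm (α := Fin n)

/-- The reduced word of an element of a factor. -/
def factorWord : ∀ i, FreeFactor m n i → GroupWord (Fin m ⊕ Fin n)
  | false => fun x => (FreeGroup.toWord (α := Fin m) x).map fun a => (Sum.inl a.1, a.2)
  | true => fun x => (FreeGroup.toWord (α := Fin n) x).map fun a => (Sum.inr a.1, a.2)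

lemma length_factorWord (i : Bool) (x : FreeFactor m n i) :
    (factorWord i x).length = factorLen i x := by
  cases i <;> simp [factorWord, factorLen, FreeGroup.norm]

lemma factorLen_mul_le (i : Bool) (x y : FreeFactor m n i) :
    factorLen i (x * y) ≤ factorLen i x + factorLen i y := by
  cases i
  · exact FreeGroup.norm_mul_le (α := Fin m) x y
  · exact FreeGroup.norm_mul_le (α := Fin n) x y

section Eval

variable {X : Type*} {G : Type*} [Group G] (γ : X → G)

@[simp] lemma GroupWord.eval_nil : GroupWord.eval γ [] = 1 := by
  simp [GroupWord.eval]

@[simp] lemma GroupWord.eval_append (w w' : GroupWord X) :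
    GroupWord.eval γ (w ++ w') = w.eval γ * w'.eval γ := by
  simp [GroupWord.eval]

@[simp] lemma GroupWord.eval_invRev (w : GroupWord X) :
    GroupWord.eval γ (FreeGroup.invRev w) = (w.eval γ)⁻¹ := by
  rw [GroupWord.eval, ← FreeGroup.inv_mk, _root_.map_inv, GroupWord.eval]

end Eval

/-- The value of a word in the amalgamated product. -/
abbrev evalG (φ : C →* FreeGroup (Fin m)) (ψ : C →* FreeGroup (Fin n))
    (w : GroupWord (Fin m ⊕ Fin n)) : PushoutI (factorHom φ ψ) := w.eval (Amalgam.gen φ ψ)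

lemma evalG_factorWord (i : Bool) (x : FreeFactor m n i) :
    evalG φ ψ (factorWord i x) = PushoutI.of i x := by
  cases i
  · have : (Amalgam.inl φ ψ) = FreeGroup.lift fun a => Amalgam.gen φ ψ (Sum.inl a) := by
      ext a; simp [Amalgam.gen]
    change _ = Amalgam.inl φ ψ x
    rw [this]
    conv_rhs => rw [← FreeGroup.mk_toWord (α := Fin m) (x := x)]
    rw [evalG, GroupWord.eval, FreeGroup.lift_mk, FreeGroup.lift_mk, factorWord]
    simp [Function.comp_def]
  · have : (Amalgam.inr φ ψ) = FreeGroup.lift fun a => Amalgam.gen φ ψ (Sum.inr a) := by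
      ext a; simp [Amalgam.gen]
    change _ = Amalgam.inr φ ψ x
    rw [this]
    conv_rhs => rw [← FreeGroup.mk_toWord (α := Fin n) (x := x)]
    rw [evalG, GroupWord.eval, FreeGroup.lift_mk, FreeGroup.lift_mk, factorWord]
    simp [Function.comp_def]

/-- The size of a list of syllables. -/
def sylSize (l : Syl (FreeFactor m n)) : ℕ := (l.map fun s => factorLen s.1 s.2 + 1).sum

/-- A word for the product of a list of syllables. -/
def sylWord (l : Syl (FreeFactor m n)) : GroupWord (Fin m ⊕ Fin n) :=
  l.flatMap fun s => factorWord s.1 s.2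

lemma evalG_sylWord (l : Syl (FreeFactor m n)) :
    evalG φ ψ (sylWord l) = Syl.prod (factorHom φ ψ) l := by
  induction l with
  | nil => simp [sylWord, evalG]
  | cons s t ih =>
    have : sylWord (s :: t) = factorWord s.1 s.2 ++ sylWord t := by simp [sylWord]
    rw [this, evalG, GroupWord.eval_append, ← evalG, ← evalG, ih, evalG_factorWord, prod_cons]

lemma length_sylWord_le (l : Syl (FreeFactor m n)) : (sylWord l).length ≤ sylSize l := by
  induction l with
  | nil => simp [sylWord]
  | cons s t ih =>
    simp only [sylWord, sylSize, List.flatMap_cons, List.length_append, List.map_cons,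
      List.sum_cons, length_factorWord] at ih ⊢
    omega

lemma sylSize_append (l l' : Syl (FreeFactor m n)) :
    sylSize (l ++ l') = sylSize l + sylSize l' := by simp [sylSize]

lemma length_le_sylSize (l : Syl (FreeFactor m n)) : l.length ≤ sylSize l := by
  induction l with
  | nil => simp
  | cons s t ih =>
    simp only [sylSize, List.map_cons, List.sum_cons, List.length_cons] at ih ⊢
    omega

lemma factorLen_le_sylSize {l : Syl (FreeFactor m n)} {s : Σ i, FreeFactor m n i} (h : s ∈ l) :
    factorLen s.1 s.2 ≤ sylSize l := by
  have := List.single_le_sum (l := l.map fun s => factorLen s.1 s.2 + 1) (by simp) _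
    (List.mem_map_of_mem h)
  exact (Nat.le_succ _).trans this

lemma factorHom_injective (hφ : Function.Injective φ) (hψ : Function.Injective ψ) (i : Bool) :
    Function.Injective (factorHom φ ψ i) := by
  cases i
  · exact hφ
  · exact hψ

/-- Near to the geodesics from `1` to `c` in both factors. -/
def NearBoth (φ : C →* FreeGroup (Fin m)) (ψ : C →* FreeGroup (Fin n)) (κ : ℕ) (x c : C) : Prop :=
  FreeGroup.Near φ κ x c ∧ FreeGroup.Near ψ κ x c

/-- The constant `κ` witnesses the quasiconvexity of `C` in both factors. -/
structure IsQuasiconvexConst (φ : C →* FreeGroup (Fin m)) (ψ : C →* FreeGroup (Fin n)) (κ : ℕ) :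
    Prop where
  left : ∀ c j, ∃ y, FreeGroup.norm ((FreeGroup.pre (φ c) j)⁻¹ * φ y) ≤ κ
  right : ∀ c j, ∃ y, FreeGroup.norm ((FreeGroup.pre (ψ c) j)⁻¹ * ψ y) ≤ κ
  near : ∀ c j, ∃ y, FreeGroup.norm ((FreeGroup.pre (φ c) j)⁻¹ * φ y) ≤ κ ∧ NearBoth φ ψ κ y c
  transport : ∀ i (g h : FreeFactor m n i) (c d x : C),
    factorHom φ ψ i d = g⁻¹ * factorHom φ ψ i c * h → NearBoth φ ψ κ x c →
    ∃ y, NearBoth φ ψ κ y d ∧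
      factorLen i ((factorHom φ ψ i x)⁻¹ * g * factorHom φ ψ i y) ≤
        2 * κ + max (factorLen i g) (factorLen i h)

/-- Quasiconvexity produces points near a geodesic of one factor; `exists_near_of_near` makes them
near in the other factor too. -/
lemma exists_isQuasiconvexConst {ρ : Type*} [Finite ρ] {η : FreeGroup ρ →* C}
    (hη : Function.Surjective η) (hφ : Function.Injective φ) (hψ : Function.Injective ψ) :
    ∃ κ, IsQuasiconvexConst φ ψ κ := by
  classical
  obtain ⟨K, hK⟩ := FreeGroup.exists_quasiconvex hη φ
  obtain ⟨K', hK'⟩ := FreeGroup.exists_quasiconvex hη ψ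
  obtain ⟨N, hN⟩ := FreeGroup.exists_near_of_near hη hφ hψ K
  obtain ⟨N', hN'⟩ := FreeGroup.exists_near_of_near hη hψ hφ K'
  refine ⟨K + K' + N + N', ?_, ?_, ?_, ?_⟩
  · intro c j
    obtain ⟨y, hy⟩ := hK c j
    exact ⟨y, by omega⟩
  · intro c j
    obtain ⟨y, hy⟩ := hK' c j
    exact ⟨y, by omega⟩
  · intro c j
    obtain ⟨y, hy⟩ := hK c j
    have h1 : FreeGroup.Near φ K y c := ⟨j, hy⟩
    exact ⟨y, by omega, h1.mono (by omega), (hN y c h1).mono (by omega)⟩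
  · rintro (_ | _) g h c d x hd ⟨h1, h2⟩
    · obtain ⟨y, hy, hy'⟩ := FreeGroup.exists_near_transport hK (g := g) (h := h) hd h1
      refine ⟨y, ⟨hy.mono (by omega), (hN y d hy).mono (by omega)⟩, ?_⟩
      refine Nat.le_trans hy' ?_
      change _ + max (factorLen false g) (factorLen false h) + _ ≤ _
      omega
    · obtain ⟨y, hy, hy'⟩ := FreeGroup.exists_near_transport hK' (g := g) (h := h) hd h2
      refine ⟨y, ⟨(hN' y d hy).mono (by omega), hy.mono (by omega)⟩, ?_⟩
      refine Nat.le_trans hy' ?_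
      change _ + max (factorLen true g) (factorLen true h) + _ ≤ _
      omega

/-- The point `x` is carried through the syllables: across `g` it passes from near `c` to a point
`y` near `g⁻¹ c h`, which again lies in `C`, and each crossing costs a factor element of bounded
length. Syllables alternate between factors, so nearness is kept in both. -/
lemma exists_word_coset (hφ : Function.Injective φ) (hψ : Function.Injective ψ) {κ L : ℕ}
    (hκ : IsQuasiconvexConst φ ψ κ) {l l' : Syl (FreeFactor m n)}
    (hl : IsRed (factorHom φ ψ) l) (hl' : IsRed (factorHom φ ψ) l')
    (hL : ∀ s ∈ l, factorLen s.1 s.2 ≤ L) (hL' : ∀ s ∈ l', factorLen s.1 s.2 ≤ L) {c x : C}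
    (hc : (prod (factorHom φ ψ) l')⁻¹ * PushoutI.base _ c⁻¹ * prod (factorHom φ ψ) l ∈
      (PushoutI.base (factorHom φ ψ)).range)
    (hx : NearBoth φ ψ κ x c) :
    ∃ w : GroupWord (Fin m ⊕ Fin n), w.length ≤ l.length * (2 * κ + L) ∧ ∃ e,
      PushoutI.base _ x⁻¹ * prod (factorHom φ ψ) l = evalG φ ψ w * PushoutI.base _ e := by
  have hθ := factorHom_injective hφ hψ
  induction l generalizing l' c x with
  | nil => exact ⟨[], by simp, x⁻¹, by simp [evalG]⟩
  | cons s t ih =>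
    cases l' with
    | nil =>
      rw [prod_nil, inv_one, one_mul,
        Subgroup.mul_mem_cancel_left _ (MonoidHom.mem_range.2 ⟨c⁻¹, rfl⟩)] at hc
      exact absurd (eq_nil_of_prod_mem hθ hl hc) (by simp)
    | cons s' t' =>
      obtain ⟨i, g⟩ := s
      obtain ⟨j, h⟩ := s'
      obtain ⟨rfl, d, hd⟩ := head_match hθ hl hl' hc
      have hd' : factorHom φ ψ i d⁻¹ = g⁻¹ * factorHom φ ψ i c * h := by
        apply PushoutI.of_injective hθ i
        rw [PushoutI.of_apply_eq_base, map_inv, hd]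
        simp [PushoutI.of_apply_eq_base, mul_assoc]
      obtain ⟨y, hy, hy'⟩ := hκ.transport i g h c d⁻¹ x hd' hx
      obtain ⟨w, hw, e, he⟩ := ih hl.tail hl'.tail (fun s hs => hL s (List.mem_cons_of_mem _ hs))
        (fun s hs => hL' s (List.mem_cons_of_mem _ hs)) (c := d⁻¹) (by
          rw [inv_inv, hd]
          simpa [mul_assoc] using hc) hy
      refine ⟨factorWord i ((factorHom φ ψ i x)⁻¹ * g * factorHom φ ψ i y) ++ w, ?_, e, ?_⟩
      · have h1 := hL ⟨i, g⟩ (by simp)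
        have h2 := hL' ⟨i, h⟩ (by simp)
        rw [List.length_append, length_factorWord, List.length_cons, Nat.succ_mul]
        simp only at h1 h2
        omega
      · rw [evalG, GroupWord.eval_append, ← evalG, ← evalG, mul_assoc, ← he, evalG_factorWord]
        simp [PushoutI.of_apply_eq_base, mul_assoc]

/-- Long solutions `c` of `c⁻¹ u ∈ v C` yield shorter ones. -/
lemma exists_pump (hφ : Function.Injective φ) (hψ : Function.Injective ψ) {κ L : ℕ}
    (hκ : IsQuasiconvexConst φ ψ κ) {l l' : Syl (FreeFactor m n)}
    (hl : IsRed (factorHom φ ψ) l) (hl' : IsRed (factorHom φ ψ) l')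
    (hL : ∀ s ∈ l, factorLen s.1 s.2 ≤ L) (hL' : ∀ s ∈ l', factorLen s.1 s.2 ≤ L) {c : C}
    (hc : (prod (factorHom φ ψ) l')⁻¹ * PushoutI.base _ c⁻¹ * prod (factorHom φ ψ) l ∈
      (PushoutI.base (factorHom φ ψ)).range)
    (hJ : 2 * (numWords (Fintype.card (Fin m × Bool)) κ *
      numWords (Fintype.card ((Fin m ⊕ Fin n) × Bool)) (l.length * (2 * κ + L))) ≤
        FreeGroup.norm (φ c)) :
    ∃ c', FreeGroup.norm (φ c') < FreeGroup.norm (φ c) ∧ c' ≠ 1 ∧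
      (prod (factorHom φ ψ) l')⁻¹ * PushoutI.base _ c'⁻¹ * prod (factorHom φ ψ) l ∈
      (PushoutI.base (factorHom φ ψ)).range := by
  -- `y j` is a point of `C` near the `j`-th vertex of the geodesic to `φ c`, and `w j` is a short
  -- representative of the coset `(y j)⁻¹ * prod l * C`.
  choose y hy hy' using hκ.near c
  choose w hw e he using fun j => exists_word_coset hφ hψ hκ hl hl' hL hL' hc (hy' j)
  -- When offset and coset representative agree at `i < j`, replacing `c` by `y i * (y j)⁻¹ * c`
  -- changes the product only by an element of `C` on the right.
  obtain ⟨i, j, hij, hj, h1, h2⟩ := exists_lt_eq_of_length_le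
    (fun j => ((FreeGroup.pre (φ c) j)⁻¹ * φ (y j)).toWord) w (fun j _ => hy j)
    (fun j _ => hw j) le_rfl
  rw [FreeGroup.toWord_inj] at h1
  obtain ⟨-, -, h3, h4⟩ := FreeGroup.norm_pump (φ c) hij (by omega)
  have hc' : φ (y i * (y j)⁻¹ * c) =
      FreeGroup.pre (φ c) i * (FreeGroup.pre (φ c) j)⁻¹ * φ c := by
    rw [inv_mul_eq_iff_eq_mul] at h1
    rw [map_mul, map_mul, map_inv, h1]
    group
  refine ⟨y i * (y j)⁻¹ * c, by rwa [hc'], ?_, ?_⟩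
  · rintro h
    rw [h, map_one] at hc'
    exact h4 hc'.symm
  · have hi := he i
    have hj' := he j
    rw [h2] at hi
    have : (prod (factorHom φ ψ) l')⁻¹ * PushoutI.base _ (y i * (y j)⁻¹ * c)⁻¹ *
        prod (factorHom φ ψ) l =
        ((prod (factorHom φ ψ) l')⁻¹ * PushoutI.base _ c⁻¹ * prod (factorHom φ ψ) l) *
          PushoutI.base _ ((e j)⁻¹ * e i) := by
      have h5 : PushoutI.base _ (y i)⁻¹ * prod (factorHom φ ψ) l =
          PushoutI.base _ (y j)⁻¹ * prod (factorHom φ ψ) l * PushoutI.base _ ((e j)⁻¹ * e i) := by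
        rw [hi, hj']; simp [mul_assoc]
      rw [show (y i * (y j)⁻¹ * c)⁻¹ = c⁻¹ * (y j * (y i)⁻¹) by group, map_mul, map_mul]
      rw [mul_assoc, mul_assoc, mul_assoc, h5]
      simp [mul_assoc]
    rw [this]
    exact mul_mem hc ⟨_, rfl⟩

end MainConj

/-! ### Conjugate elements have short conjugators -/

section ShortConj

open Syl

variable {m n : ℕ} {C : Type*} [Group C]
  {φ : C →* FreeGroup (Fin m)} {ψ : C →* FreeGroup (Fin n)}

/-- A bound for the lengths of conjugators, for elements of size `N`. -/
def conjBound (s κ N : ℕ) : ℕ :=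
  N + 2 * (numWords s κ * numWords s (6 * (N + κ + 1) * (N + κ + 1)))

/-- The number of letters, plus one. -/
abbrev numLetters (m n : ℕ) : ℕ := Fintype.card ((Fin m ⊕ Fin n) × Bool) + 1

lemma numWords_le_numLetters {t k k' m n : ℕ} (ht : t ≤ numLetters m n) (hk : k ≤ k') :
    numWords t k ≤ numWords (numLetters m n) k' :=
  (numWords_mono_left ht k).trans (numWords_mono (numLetters m n) (Nat.le_add_left 1 _) hk)

lemma card_left_le (m n : ℕ) : Fintype.card (Fin m × Bool) ≤ numLetters m n := by
  simp [numLetters]; omega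

lemma card_right_le (m n : ℕ) : Fintype.card (Fin n × Bool) ≤ numLetters m n := by
  simp [numLetters]; omega

/-- Every syllable list with a prefix from `C` is of size at most `N`. -/
def SizeLE (φ : C →* FreeGroup (Fin m)) (ψ : C →* FreeGroup (Fin n)) (c : C)
    (l : Syl (FreeFactor m n)) (N : ℕ) : Prop :=
  ∀ i, factorLen i (factorHom φ ψ i c) + sylSize l ≤ N

lemma factorLen_le_of_eq (hφ : Function.Injective φ) (hψ : Function.Injective ψ) {c : C}
    {l : Syl (FreeFactor m n)} {N : ℕ} (hN : SizeLE φ ψ c l N) (hl : IsRed (factorHom φ ψ) l)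
    {j : Bool} {a : FreeFactor m n j}
    (h : PushoutI.base _ c * prod (factorHom φ ψ) l = PushoutI.of j a) : factorLen j a ≤ N := by
  have hθ := factorHom_injective hφ hψ
  by_cases ha : a ∈ (factorHom φ ψ j).range
  · have := eq_nil_of_prod_mem hθ hl (by
      rw [← Subgroup.mul_mem_cancel_left _ (MonoidHom.mem_range.2 ⟨c, rfl⟩), h]
      exact (of_mem_base_range hθ).2 ha)
    subst this
    rw [prod_nil, mul_one, ← PushoutI.of_apply_eq_base _ j] at h
    rw [← PushoutI.of_injective hθ j h]
    exact (Nat.le_add_right _ _).trans (hN j)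
  · have := tags_eq_of_eq hθ (a := c) (b := 1) (c := 1) (d := 1) hl (isRed_singleton ha)
      (by simp [h])
    obtain ⟨⟨i, g⟩, rfl⟩ : ∃ s, l = [s] := by
      rw [← List.length_eq_one_iff, ← length_tags, this]
      rfl
    simp only [tags_cons, tags_nil, List.cons.injEq, and_true] at this
    subst this
    rw [prod_cons, prod_nil, mul_one, base_mul_of] at h
    rw [← PushoutI.of_injective hθ _ h]
    refine (factorLen_mul_le _ _ _).trans (le_trans ?_ (hN i))
    simp [sylSize]

/-- The prefix merges with the first syllable. `SizeLE` bounds `c` in both factors, so the bound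
survives whichever factor that is. -/
lemma exists_absorb {c : C} {l : Syl (FreeFactor m n)} {N : ℕ} (hN : SizeLE φ ψ c l N)
    (hl : IsRed (factorHom φ ψ) l) (hne : l ≠ []) :
    ∃ l', PushoutI.base _ c * prod (factorHom φ ψ) l = prod (factorHom φ ψ) l' ∧
      IsRed (factorHom φ ψ) l' ∧ l'.tags = l.tags ∧ sylSize l' ≤ N := by
  obtain ⟨⟨i, g⟩, t, rfl⟩ := List.exists_cons_of_ne_nil hne
  refine ⟨⟨i, factorHom φ ψ i c * g⟩ :: t, by simp [← mul_assoc, base_mul_of], ?_, rfl, ?_⟩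
  · rw [isRed_cons_iff] at hl ⊢
    rw [Subgroup.mul_mem_cancel_left _ (MonoidHom.mem_range.2 ⟨c, rfl⟩)]
    exact hl
  · have h1 := hN i
    have h2 := factorLen_mul_le i (factorHom φ ψ i c) g
    simp only [sylSize, List.map_cons, List.sum_cons] at h1 ⊢
    omega

lemma factor_exists_short_conj {j : Bool} {a b ζ : FreeFactor m n j} (κ : ℕ) {N : ℕ}
    (ha : factorLen j a ≤ N) (hb : factorLen j b ≤ N) (h : ζ⁻¹ * a * ζ = b) :
    ∃ ζ', ζ'⁻¹ * a * ζ' = b ∧ factorLen j ζ' ≤ conjBound (numLetters m n) κ N := by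
  -- The term `6 * (N + κ + 1) * (N + κ + 1)` of `conjBound` dominates the displacement bound `6 *
  -- N`; it is quadratic for the sake of the hyperbolic case, where it bounds up to `N` syllables at
  -- cost `2 * κ + N` each.
  have key : ∀ t ≤ numLetters m n, 2 * numWords t (3 * (factorLen j a + factorLen j b)) ≤
      conjBound (numLetters m n) κ N := by
    intro t ht
    have h1 := numWords_le_numLetters (k := 3 * (factorLen j a + factorLen j b))
      (k' := 6 * (N + κ + 1) * (N + κ + 1)) ht (by nlinarith)
    have h2 := one_le_numWords (numLetters m n) κ
    rw [conjBound]
    nlinarith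
  cases j
  · obtain ⟨z, h1, h2⟩ := FreeGroup.exists_short_conj h
    exact ⟨z, h1, Nat.le_trans h2 (key _ (card_left_le m n))⟩
  · obtain ⟨z, h1, h2⟩ := FreeGroup.exists_short_conj h
    exact ⟨z, h1, Nat.le_trans h2 (key _ (card_right_le m n))⟩

lemma factor_mem_range {κ : ℕ} (hκ : IsQuasiconvexConst φ ψ κ) {j : Bool} {a : FreeFactor m n j}
    {N : ℕ} (ha : factorLen j a ≤ N)
    (hE : ∀ g, factorLen j g ≤ conjBound (numLetters m n) κ N →
      g⁻¹ * a * g ∈ (factorHom φ ψ j).range → g ∈ (factorHom φ ψ j).range)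
    (g : FreeFactor m n j) (hg : g⁻¹ * a * g ∈ (factorHom φ ψ j).range) :
    g ∈ (factorHom φ ψ j).range := by
  have key : ∀ t ≤ numLetters m n, 2 * numWords t (3 * (2 * factorLen j a + 2 * κ)) ≤
      conjBound (numLetters m n) κ N := by
    intro t ht
    have h1 := numWords_le_numLetters (k := 3 * (2 * factorLen j a + 2 * κ))
      (k' := 6 * (N + κ + 1) * (N + κ + 1)) ht (by nlinarith)
    have h2 := one_le_numWords (numLetters m n) κ
    rw [conjBound]
    nlinarith
  cases j
  · exact FreeGroup.mem_range_of_conj_mem_range hκ.left a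
      (fun g hg => hE g (Nat.le_trans hg (key _ (card_left_le m n)))) g hg
  · exact FreeGroup.mem_range_of_conj_mem_range hκ.right a
      (fun g hg => hE g (Nat.le_trans hg (key _ (card_right_le m n)))) g hg

/-- Elliptic elements: conjugate elements are conjugate by a short element. -/
lemma exists_short_conj_of_elliptic (hφ : Function.Injective φ) (hψ : Function.Injective ψ)
    {κ N : ℕ} (hκ : IsQuasiconvexConst φ ψ κ) {c d : C} {l l' : Syl (FreeFactor m n)}
    (hl : IsRed (factorHom φ ψ) l) (hl' : IsRed (factorHom φ ψ) l')
    (hN : SizeLE φ ψ c l N) (hN' : SizeLE φ ψ d l' N) (hlen : l.length ≤ 1)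
    (hE : ∀ w : GroupWord (Fin m ⊕ Fin n), w.length ≤ conjBound (numLetters m n) κ N →
      (evalG φ ψ w)⁻¹ * (PushoutI.base _ c * prod (factorHom φ ψ) l) * evalG φ ψ w ∈
        (PushoutI.base (factorHom φ ψ)).range →
      evalG φ ψ w ∈ (PushoutI.base (factorHom φ ψ)).range)
    (hc : CycTags l'.tags) {z : PushoutI (factorHom φ ψ)}
    (hz : z⁻¹ * (PushoutI.base _ c * prod (factorHom φ ψ) l) * z =
      PushoutI.base _ d * prod (factorHom φ ψ) l') :
    ∃ w : GroupWord (Fin m ⊕ Fin n), w.length ≤ conjBound (numLetters m n) κ N ∧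
      (evalG φ ψ w)⁻¹ * (PushoutI.base _ c * prod (factorHom φ ψ) l) * evalG φ ψ w =
        PushoutI.base _ d * prod (factorHom φ ψ) l' := by
  have hθ := factorHom_injective hφ hψ
  obtain ⟨i, hi⟩ : ∃ i, PushoutI.base _ c * prod (factorHom φ ψ) l ∈
      (PushoutI.of (φ := factorHom φ ψ) i).range := by
    match l, hlen with
    | [], _ => exact ⟨false, factorHom φ ψ false c, by simp [PushoutI.of_apply_eq_base]⟩
    | [⟨i, g⟩], _ => exact ⟨i, factorHom φ ψ i c * g, by simp [PushoutI.of_apply_eq_base]⟩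
  -- `factor_mem_range` extends the test on short words to all elements of a factor containing `u`.
  obtain ⟨j, ⟨a, ha⟩, ζ, rfl⟩ := exists_of_conj_elliptic hθ hi (fun j ⟨a, ha⟩ g hg => by
    refine factor_mem_range hκ (factorLen_le_of_eq hφ hψ hN hl ha.symm) ?_ g ?_
    · intro g hg hgC
      have := hE (factorWord j g) (by rwa [length_factorWord])
      rw [evalG_factorWord, ← ha, ← map_inv, ← map_mul, ← map_mul, of_mem_base_range hθ,
        of_mem_base_range hθ] at this
      exact this hgC
    · rwa [← ha, ← map_inv, ← map_mul, ← map_mul, of_mem_base_range hθ] at hg) hl' hc hz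
  rw [← ha, ← map_inv, ← map_mul, ← map_mul] at hz
  obtain ⟨ζ', h1, h2⟩ := factor_exists_short_conj κ (factorLen_le_of_eq hφ hψ hN hl ha.symm)
    (factorLen_le_of_eq hφ hψ hN' hl' hz.symm) rfl
  refine ⟨factorWord j ζ', by rwa [length_factorWord], ?_⟩
  rw [evalG_factorWord, ← ha, ← map_inv, ← map_mul, ← map_mul, h1, hz]

/-- Cyclically reduced elements of length at least `2` outside the generalized normalizer:
conjugate elements are conjugate by a short element. -/
lemma exists_short_conj_of_hyperbolic (hφ : Function.Injective φ) (hψ : Function.Injective ψ)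
    {κ N : ℕ} (hκ : IsQuasiconvexConst φ ψ κ) {c d : C} {l l' : Syl (FreeFactor m n)}
    (hl : IsRed (factorHom φ ψ) l) (hl' : IsRed (factorHom φ ψ) l')
    (hN : SizeLE φ ψ c l N) (hN' : SizeLE φ ψ d l' N) (hh : l.tags.head? ≠ l.tags.getLast?)
    (hE : ∀ w : GroupWord (Fin m ⊕ Fin n), w.length ≤ conjBound (numLetters m n) κ N →
      evalG φ ψ w ∈ (PushoutI.base (factorHom φ ψ)).range →
      (PushoutI.base _ c * prod (factorHom φ ψ) l)⁻¹ * evalG φ ψ w *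
        (PushoutI.base _ c * prod (factorHom φ ψ) l) ∈ (PushoutI.base (factorHom φ ψ)).range →
      evalG φ ψ w = 1)
    (hc : CycTags l'.tags) {z : PushoutI (factorHom φ ψ)}
    (hz : z⁻¹ * (PushoutI.base _ c * prod (factorHom φ ψ) l) * z =
      PushoutI.base _ d * prod (factorHom φ ψ) l') :
    ∃ w : GroupWord (Fin m ⊕ Fin n), w.length ≤ conjBound (numLetters m n) κ N ∧
      (evalG φ ψ w)⁻¹ * (PushoutI.base _ c * prod (factorHom φ ψ) l) * evalG φ ψ w =
        PushoutI.base _ d * prod (factorHom φ ψ) l' := by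
  have hθ := factorHom_injective hφ hψ
  obtain ⟨lu, hu, hlu, htu, hsu⟩ := exists_absorb hN hl (by rintro rfl; simp at hh)
  rw [hu] at hz hE ⊢
  rw [← htu] at hh
  have hlen2 : 2 ≤ lu.length := by
    obtain ⟨a, k, b, rfl, -⟩ := exists_eq_cons_append_singleton hh
    simp
  -- Rotation and conjugation by `C` preserve the number of syllables, so `l'` also has at least
  -- two.
  have hne : l' ≠ [] ∧ l'.tags.head? ≠ l'.tags.getLast? := by
    have h2 : ¬ l'.length ≤ 1 := by
      intro h1
      obtain ⟨lz, e, rfl, hlz⟩ := exists_form z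
      obtain ⟨l₁, e', h3, h4, h5⟩ := exists_rotation hθ hlu hh hlz hl' hc hz
      have := tags_eq_of_eq hθ (a := e'⁻¹) (b := e') (c := d) (d := 1) h4 hl'
        (by simpa using h5)
      have := congrArg List.length this
      have h6 := h3.perm.length_eq
      simp only [length_tags] at this
      omega
    refine ⟨by rintro rfl; simp at h2, hc.resolve_left (by simpa using h2)⟩
  obtain ⟨lv, hv, hlv, htv, hsv⟩ := exists_absorb hN' hl' hne.1
  rw [hv] at hz ⊢
  rw [← htv] at hne
  -- Using `z⁻¹` makes the rotation happen on the side of `v`: `e'` conjugates a rotation of `v` to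
  -- `u` itself, the element about which `hE` speaks.
  obtain ⟨lz, e, hze, hlz⟩ := exists_form z⁻¹
  obtain ⟨l₁, e', h3, hl₁, h5⟩ := exists_rotation hθ hlv hne.2 hlz hlu (.inr hh) (c := e) (d := 1)
    (by rw [← hze, ← hz, map_one]; group)
  rw [map_one, one_mul] at h5
  have hmem : ∀ s ∈ l₁, factorLen s.1 s.2 ≤ N := fun s hs =>
    (factorLen_le_sylSize (h3.perm.mem_iff.2 hs)).trans hsv
  have hmemu : ∀ s ∈ lu, factorLen s.1 s.2 ≤ N := fun s hs => (factorLen_le_sylSize hs).trans hsu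
  set J := numWords (Fintype.card (Fin m × Bool)) κ *
    numWords (Fintype.card ((Fin m ⊕ Fin n) × Bool)) (lu.length * (2 * κ + N)) with hJ
  -- `N` pays for the rotated prefix of `v`, and `2 * J` for the element of `C`.
  have hJB : N + 2 * J ≤ conjBound (numLetters m n) κ N := by
    have h6 := (length_le_sylSize lu).trans hsu
    have h7 : lu.length * (2 * κ + N) ≤ 6 * (N + κ + 1) * (N + κ + 1) :=
      (Nat.mul_le_mul_right _ h6).trans (by nlinarith)
    have h8 := Nat.mul_le_mul (numWords_le_numLetters (card_left_le m n) (le_refl κ))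
      (numWords_le_numLetters (t := Fintype.card ((Fin m ⊕ Fin n) × Bool)) (m := m) (n := n)
        (Nat.le_succ _) h7)
    rw [conjBound]
    omega
  have hword : ∀ c : C, evalG φ ψ (factorWord false (φ c)) = PushoutI.base _ c ∧
      (factorWord (m := m) (n := n) false (φ c)).length = FreeGroup.norm (φ c) := fun c =>
    ⟨(evalG_factorWord false (φ c)).trans (PushoutI.of_apply_eq_base (factorHom φ ψ) false c),
      length_factorWord _ _⟩
  -- A long nontrivial `k` pumps down to a shorter nontrivial one, and the short ones are excluded
  -- by `hE`.
  have htriv : ∀ k : C, (prod (factorHom φ ψ) lu)⁻¹ * PushoutI.base _ k⁻¹ *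
      prod (factorHom φ ψ) lu ∈ (PushoutI.base (factorHom φ ψ)).range → k = 1 := by
    intro k hk
    induction hn : FreeGroup.norm (φ k) using Nat.strong_induction_on generalizing k with
    | _ r ih =>
      rcases le_total (2 * J) (FreeGroup.norm (φ k)) with h6 | h6
      · obtain ⟨k', h7, h8, h9⟩ := exists_pump hφ hψ hκ hlu hlu hmemu hmemu hk h6
        exact absurd (ih _ (hn ▸ h7) k' h9 rfl) h8
      · have := hE (factorWord false (φ k)) (by rw [(hword k).2]; omega)
          (by rw [(hword k).1]; exact ⟨k, rfl⟩) (by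
          rw [(hword k).1]
          have h7 := inv_mem hk
          simpa [mul_assoc] using h7)
        rw [(hword k).1, ← map_one (PushoutI.base _)] at this
        exact PushoutI.base_injective hθ this
  have hS : (prod (factorHom φ ψ) l₁)⁻¹ * PushoutI.base _ e'⁻¹⁻¹ * prod (factorHom φ ψ) lu ∈
      (PushoutI.base (factorHom φ ψ)).range := by
    rw [← h5, inv_inv]
    exact ⟨e', by group⟩
  -- If `e'⁻¹` were long, pumping would give a different solution `k'`; but `htriv`, applied to `k'
  -- * e'`, forces `k' = e'⁻¹`.
  have hshort : FreeGroup.norm (φ e'⁻¹) ≤ 2 * J := by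
    by_contra h6
    obtain ⟨k', h7, -, h9⟩ := exists_pump hφ hψ hκ hlu hl₁ hmemu hmem hS (not_le.1 h6).le
    have h10 := mul_mem (inv_mem hS) h9
    have h11 := htriv (k' * e'⁻¹⁻¹) (by
      rw [mul_inv_rev, inv_inv]
      simpa [mul_assoc] using h10)
    rw [mul_inv_eq_one] at h11
    rw [h11] at h7
    exact lt_irrefl _ h7
  obtain ⟨k, hk, hrot⟩ := List.isRotated_iff_mod.1 h3
  rw [List.rotate_eq_drop_append_take hk] at hrot
  have hsplit : prod (factorHom φ ψ) lv =
      prod (factorHom φ ψ) (lv.take k) * prod (factorHom φ ψ) (lv.drop k) := by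
    rw [← prod_append, List.take_append_drop]
  -- With `p` the product of `lv.take k`, the rotation is `p⁻¹ v p = e' u e'⁻¹`, so `e'⁻¹ p⁻¹`
  -- conjugates `u` to `v`.
  refine ⟨factorWord false (φ e'⁻¹) ++ FreeGroup.invRev (sylWord (lv.take k)), ?_, ?_⟩
  · have h6 := length_sylWord_le (lv.take k)
    have h7 : sylSize (lv.take k) ≤ sylSize lv := by
      conv_rhs => rw [← List.take_append_drop k lv, sylSize_append]
      omega
    rw [List.length_append, FreeGroup.invRev_length, (hword e'⁻¹).2]
    omega
  · rw [evalG, GroupWord.eval_append, GroupWord.eval_invRev, ← evalG, ← evalG, (hword e'⁻¹).1,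
      evalG_sylWord, ← h5, ← hrot, prod_append, hsplit, map_inv]
    group

end ShortConj

/-! ### Primitive recursive operations on words -/

section PrimrecWords

variable {α : Type*} [Primcodable α]

lemma FreeGroup.primrec_reduce [DecidableEq α] :
    Primrec (FreeGroup.reduce : List (α × Bool) → List (α × Bool)) := by
  have h : Primrec fun w : List (α × Bool) => w.foldr (fun a r => (r.casesOn [a] fun b t =>
      if a.1 = b.1 ∧ a.2 = !b.2 then t else a :: b :: t : List (α × Bool))) [] := by
    refine Primrec.list_foldr (h := fun _ p => (p.2.casesOn [p.1] fun b t =>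
      if p.1.1 = b.1 ∧ p.1.2 = !b.2 then t else p.1 :: b :: t : List (α × Bool)))
      Primrec.id (Primrec.const ([] : List (α × Bool))) ?_
    have hb : Primrec fun p : (List (α × Bool) × ((α × Bool) × List (α × Bool))) ×
        ((α × Bool) × List (α × Bool)) => p.2.1 := Primrec.fst.comp Primrec.snd
    have ha : Primrec fun p : (List (α × Bool) × ((α × Bool) × List (α × Bool))) ×
        ((α × Bool) × List (α × Bool)) => p.1.2.1 :=
      Primrec.fst.comp (Primrec.snd.comp Primrec.fst)
    have ht : Primrec fun p : (List (α × Bool) × ((α × Bool) × List (α × Bool))) ×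
        ((α × Bool) × List (α × Bool)) => p.2.2 := Primrec.snd.comp Primrec.snd
    refine Primrec.list_casesOn (f := fun p : List (α × Bool) × ((α × Bool) × List (α × Bool)) =>
      p.2.2) (h := fun p q => if p.2.1.1 = q.1.1 ∧ p.2.1.2 = !q.1.2 then q.2
        else p.2.1 :: q.1 :: q.2) (Primrec.snd.comp Primrec.snd)
      (Primrec.list_cons.comp (Primrec.fst.comp Primrec.snd) (Primrec.const [])) ?_
    refine Primrec.ite (PrimrecPred.and ?_ ?_) ht
      (Primrec.list_cons.comp ha (Primrec.list_cons.comp hb ht))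
    · exact Primrec.eq.comp (Primrec.fst.comp ha) (Primrec.fst.comp hb)
    · exact Primrec.eq.comp (Primrec.snd.comp ha) (Primrec.not.comp (Primrec.snd.comp hb))
  refine h.of_eq fun w => ?_
  induction w with
  | nil => rfl
  | cons a w ih =>
    rw [List.foldr_cons, ih, FreeGroup.reduce.cons]

lemma FreeGroup.primrecPred_mk_eq_one : PrimrecPred fun w : List (α × Bool) =>
    FreeGroup.mk w = 1 := by
  classical
  refine (Primrec.eq.comp FreeGroup.primrec_reduce (Primrec.const [])).of_eq fun w => ?_
  rw [← FreeGroup.toWord_mk, FreeGroup.toWord_eq_nil_iff]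

lemma FreeGroup.primrec_invRev :
    Primrec (FreeGroup.invRev : List (α × Bool) → List (α × Bool)) := by
  refine Primrec.list_reverse.comp (Primrec.list_map Primrec.id ?_)
  exact Primrec.pair (Primrec.fst.comp Primrec.snd)
    (Primrec.not.comp (Primrec.snd.comp Primrec.snd))

lemma primrec_wordsLE (letters : List α) : Primrec (wordsLE letters) := by
  refine (Primrec.nat_rec₁ (f := fun _ r => [] :: r.flatMap fun w => letters.map (· :: w)) [[]]
    ?_).of_eq fun k => ?_
  · refine Primrec.list_cons.comp (Primrec.const []) (Primrec.list_flatMap Primrec.snd ?_)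
    refine Primrec.list_map (Primrec.const letters) ?_
    exact Primrec.list_cons.comp Primrec.snd (Primrec.snd.comp Primrec.fst)
  · induction k with
    | zero => rfl
    | succ k ih => simp only [wordsLE, ← ih]

lemma primrec_numWords (s : ℕ) : Primrec (numWords s) := by
  refine (Primrec.nat_rec₁ (f := fun _ r => 1 + s * r) 1 ?_).of_eq fun k => ?_
  · exact Primrec.nat_add.comp (Primrec.const 1)
      (Primrec.nat_mul.comp (Primrec.const s) Primrec.snd)
  · induction k with
    | zero => rfl
    | succ k ih => simp only [numWords, ← ih]

lemma primrec_conjBound (s κ : ℕ) : Primrec (conjBound s κ) := by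
  have h1 : Primrec fun N => N + κ + 1 := by
    exact Primrec.nat_add.comp (Primrec.nat_add.comp Primrec.id (Primrec.const κ))
      (Primrec.const 1)
  have h2 : Primrec fun N => 6 * (N + κ + 1) * (N + κ + 1) :=
    Primrec.nat_mul.comp (Primrec.nat_mul.comp (Primrec.const 6) h1) h1
  exact Primrec.nat_add.comp Primrec.id (Primrec.nat_mul.comp (Primrec.const 2)
    (Primrec.nat_mul.comp (Primrec.const _) ((primrec_numWords s).comp h2)))

end PrimrecWords

/-! ### Computing normal forms -/

section NormalForm

open Syl

variable {m n : ℕ}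

/-- The inclusion of a factor into the free product of the factors. -/
def factorEmb (m n : ℕ) : ∀ i, FreeFactor m n i →* FreeGroup (Fin m ⊕ Fin n)
  | false => FreeGroup.map (α := Fin m) Sum.inl
  | true => FreeGroup.map (α := Fin n) Sum.inr

/-- The projection of the free product of the factors onto a factor. -/
def factorProj (m n : ℕ) : ∀ i, FreeGroup (Fin m ⊕ Fin n) →* FreeFactor m n i
  | false => FreeGroup.lift (β := FreeGroup (Fin m)) (Sum.elim FreeGroup.of fun _ => 1)
  | true => FreeGroup.lift (β := FreeGroup (Fin n)) (Sum.elim (fun _ => 1) FreeGroup.of)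

@[simp] lemma factorProj_factorEmb (i : Bool) (x : FreeFactor m n i) :
    factorProj m n i (factorEmb m n i x) = x := by
  cases i
  · have : (factorProj m n false).comp (factorEmb m n false) =
        MonoidHom.id (FreeGroup (Fin m)) := by
      apply FreeGroup.ext_hom
      intro a
      change FreeGroup.lift _ (FreeGroup.map _ (FreeGroup.of a)) = FreeGroup.of a
      simp
    exact DFunLike.congr_fun this x
  · have : (factorProj m n true).comp (factorEmb m n true) =
        MonoidHom.id (FreeGroup (Fin n)) := by
      apply FreeGroup.ext_hom
      intro a
      change FreeGroup.lift _ (FreeGroup.map _ (FreeGroup.of a)) = FreeGroup.of a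
      simp
    exact DFunLike.congr_fun this x

/-- Elements of both factors are handled as words over the common alphabet; equality is then decided
by free reduction in a single free group. -/
lemma mk_factorWord (i : Bool) (x : FreeFactor m n i) :
    FreeGroup.mk (factorWord i x) = factorEmb m n i x := by
  cases i
  · conv_rhs => rw [← FreeGroup.mk_toWord (α := Fin m) (x := x)]
    rfl
  · conv_rhs => rw [← FreeGroup.mk_toWord (α := Fin n) (x := x)]
    rfl

lemma mk_letter (x : (Fin m ⊕ Fin n) × Bool) :
    FreeGroup.mk [x] = factorEmb m n x.1.isRight (factorProj m n x.1.isRight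
      (FreeGroup.mk [x])) := by
  obtain ⟨a | a, b⟩ := x <;> cases b <;> simp [factorEmb, factorProj] <;> rfl

variable {C : Type*} [Group C] (φ : C →* FreeGroup (Fin m)) (ψ : C →* FreeGroup (Fin n))

lemma evalG_eq_of {i : Bool} {x : FreeFactor m n i} {w : GroupWord (Fin m ⊕ Fin n)}
    (h : FreeGroup.mk w = factorEmb m n i x) : evalG φ ψ w = PushoutI.of i x := by
  rw [← mk_factorWord] at h
  rw [← evalG_factorWord, evalG, evalG, GroupWord.eval, h, GroupWord.eval]

lemma exists_factorLen_factorProj_le : ∃ D, ∀ i (w : GroupWord (Fin m ⊕ Fin n)),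
    factorLen i (factorProj m n i (FreeGroup.mk w)) ≤ D * w.length := by
  obtain ⟨D, hD⟩ := FreeGroup.exists_norm_map_le (β := Fin m) (factorProj m n false)
  obtain ⟨E, hE⟩ := FreeGroup.exists_norm_map_le (β := Fin n) (factorProj m n true)
  refine ⟨D + E, ?_⟩
  rintro (_ | _) w
  · exact (hD _).trans (Nat.mul_le_mul (Nat.le_add_right _ _) FreeGroup.norm_mk_le)
  · exact (hE _).trans (Nat.mul_le_mul (Nat.le_add_left _ _) FreeGroup.norm_mk_le)

variable {r : ℕ} (η : FreeGroup (Fin r) →* C)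

/-- A word for the image in a factor of the element of `C` given by a word. -/
def baseWord (i : Bool) (z : GroupWord (Fin r)) : GroupWord (Fin m ⊕ Fin n) :=
  z.flatMap fun a => factorWord i (factorHom φ ψ i (η (FreeGroup.mk [a])))

lemma mk_baseWord (i : Bool) (z : GroupWord (Fin r)) :
    FreeGroup.mk (baseWord φ ψ η i z) =
      factorEmb m n i (factorHom φ ψ i (η (FreeGroup.mk z))) := by
  induction z with
  | nil => rw [← FreeGroup.one_eq_mk]; simp [baseWord, ← FreeGroup.one_eq_mk]
  | cons a z ih =>
    rw [show FreeGroup.mk (a :: z) = FreeGroup.mk [a] * FreeGroup.mk z by simp, map_mul, map_mul,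
      map_mul, ← ih, ← mk_factorWord, FreeGroup.mul_mk]
    simp [baseWord]

open Classical in
/-- The first word of length at most `K * w.length` for an element of `C` whose image in a factor
is given by the word `w`. -/
noncomputable def findBase (K : ℕ) (i : Bool) (w : GroupWord (Fin m ⊕ Fin n)) : Option (GroupWord (Fin r)) :=
  ((wordsLE (Finset.univ : Finset (Fin r × Bool)).toList (K * w.length)).filter fun z =>
    FreeGroup.mk (w ++ FreeGroup.invRev (baseWord φ ψ η i z)) = 1).head?

/-- Intermediate results: a word for an element of `C`, and words for syllables. -/
abbrev NFState (r m n : ℕ) : Type :=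
  GroupWord (Fin r) × List (Bool × GroupWord (Fin m ⊕ Fin n))

/-- Multiply by an element of a factor, when the first syllable is in the other factor. -/
noncomputable def putSyllable (K : ℕ) (i : Bool) (w : GroupWord (Fin m ⊕ Fin n))
    (l : List (Bool × GroupWord (Fin m ⊕ Fin n))) : NFState r m n :=
  match findBase φ ψ η K i w with
  | none => ([], (i, w) :: l)
  | some z => (z, l)

/-- Multiply by a letter. -/
noncomputable def nfStep (K : ℕ) (x : (Fin m ⊕ Fin n) × Bool) (s : NFState r m n) : NFState r m n :=
  match s.2 with
  | [] => putSyllable φ ψ η K x.1.isRight (x :: baseWord φ ψ η x.1.isRight s.1) []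
  | t :: l => if t.1 = x.1.isRight
      then putSyllable φ ψ η K x.1.isRight (x :: (baseWord φ ψ η x.1.isRight s.1 ++ t.2)) l
      else putSyllable φ ψ η K x.1.isRight (x :: baseWord φ ψ η x.1.isRight s.1) (t :: l)

/-- A normal form of the element given by a word. -/
noncomputable def normalForm (K : ℕ) (w : GroupWord (Fin m ⊕ Fin n)) : NFState r m n :=
  w.foldr (nfStep φ ψ η K) ([], [])

lemma primrec_baseWord : Primrec₂ (baseWord φ ψ η) := by
  refine Primrec.list_flatMap Primrec.snd ?_
  exact (Primrec.dom_finite fun p : Bool × (Fin r × Bool) =>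
    factorWord p.1 (factorHom φ ψ p.1 (η (FreeGroup.mk [p.2])))).comp
    (Primrec.pair (Primrec.fst.comp Primrec.fst) Primrec.snd)

lemma primrec_findBase (K : ℕ) : Primrec₂ (findBase φ ψ η K) := by
  have hR : PrimrecRel fun (z : GroupWord (Fin r)) (p : Bool × GroupWord (Fin m ⊕ Fin n)) =>
      FreeGroup.mk (p.2 ++ FreeGroup.invRev (baseWord φ ψ η p.1 z)) = 1 := by
    refine FreeGroup.primrecPred_mk_eq_one.comp (Primrec.list_append.comp
      (Primrec.snd.comp Primrec.snd) (FreeGroup.primrec_invRev.comp ?_))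
    exact (primrec_baseWord φ ψ η).comp (Primrec.fst.comp Primrec.snd) Primrec.fst
  classical
  have := Primrec.list_head?.comp ((hR.listFilter).comp ((primrec_wordsLE
    (Finset.univ : Finset (Fin r × Bool)).toList).comp (Primrec.nat_mul.comp (Primrec.const K)
    (Primrec.list_length.comp (Primrec.snd (α := Bool)
      (β := GroupWord (Fin m ⊕ Fin n)))))) Primrec.id)
  refine this.of_eq fun p => ?_
  simp only [findBase, id]

lemma primrec_putSyllable (K : ℕ) :
    Primrec fun p : Bool × GroupWord (Fin m ⊕ Fin n) × List (Bool × GroupWord (Fin m ⊕ Fin n)) =>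
      putSyllable φ ψ η K p.1 p.2.1 p.2.2 := by
  have h := Primrec.option_casesOn (σ := NFState r m n)
    (f := fun p : Bool × GroupWord (Fin m ⊕ Fin n) × List (Bool × GroupWord (Fin m ⊕ Fin n)) =>
      ([], (p.1, p.2.1) :: p.2.2)) (g := fun p z => (z, p.2.2))
    ((primrec_findBase φ ψ η K).comp Primrec.fst (Primrec.fst.comp Primrec.snd))
    (Primrec.pair (Primrec.const []) (Primrec.list_cons.comp (Primrec.pair Primrec.fst
      (Primrec.fst.comp Primrec.snd)) (Primrec.snd.comp Primrec.snd)))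
    (Primrec.pair Primrec.snd (Primrec.snd.comp (Primrec.snd.comp Primrec.fst)))
  refine h.of_eq fun p => ?_
  rw [putSyllable]
  cases findBase φ ψ η K p.1 p.2.1 <;> rfl

lemma primrec_nfStep (K : ℕ) : Primrec₂ (nfStep φ ψ η K) := by
  have hp := primrec_putSyllable φ ψ η K
  have hi : Primrec fun x : (Fin m ⊕ Fin n) × Bool => x.1.isRight := Primrec.dom_finite _
  have hw : Primrec fun p : ((Fin m ⊕ Fin n) × Bool) × NFState r m n =>
      baseWord φ ψ η p.1.1.isRight p.2.1 :=
    (primrec_baseWord φ ψ η).comp (hi.comp Primrec.fst) (Primrec.fst.comp Primrec.snd)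
  have h := Primrec.list_casesOn (σ := NFState r m n)
    (f := fun p : ((Fin m ⊕ Fin n) × Bool) × NFState r m n => p.2.2)
    (g := fun p => putSyllable φ ψ η K p.1.1.isRight
      (p.1 :: baseWord φ ψ η p.1.1.isRight p.2.1) [])
    (h := fun p q => if q.1.1 = p.1.1.isRight
      then putSyllable φ ψ η K p.1.1.isRight
        (p.1 :: (baseWord φ ψ η p.1.1.isRight p.2.1 ++ q.1.2)) q.2
      else putSyllable φ ψ η K p.1.1.isRight
        (p.1 :: baseWord φ ψ η p.1.1.isRight p.2.1) (q.1 :: q.2))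
    (Primrec.snd.comp Primrec.snd)
    (hp.comp (Primrec.pair (hi.comp Primrec.fst) (Primrec.pair
      (Primrec.list_cons.comp Primrec.fst hw) (Primrec.const []))))
    (Primrec.ite (Primrec.eq.comp (Primrec.fst.comp (Primrec.fst.comp Primrec.snd))
        (hi.comp (Primrec.fst.comp Primrec.fst)))
      (hp.comp (Primrec.pair (hi.comp (Primrec.fst.comp Primrec.fst)) (Primrec.pair
        (Primrec.list_cons.comp (Primrec.fst.comp Primrec.fst) (Primrec.list_append.comp
          (hw.comp Primrec.fst) (Primrec.snd.comp (Primrec.fst.comp Primrec.snd))))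
        (Primrec.snd.comp Primrec.snd))))
      (hp.comp (Primrec.pair (hi.comp (Primrec.fst.comp Primrec.fst)) (Primrec.pair
        (Primrec.list_cons.comp (Primrec.fst.comp Primrec.fst) (hw.comp Primrec.fst))
        (Primrec.list_cons.comp (Primrec.fst.comp Primrec.snd)
          (Primrec.snd.comp Primrec.snd))))))
  refine h.of_eq fun p => ?_
  rw [nfStep]
  cases p.2.2 <;> rfl

lemma primrec_normalForm (K : ℕ) : Primrec (normalForm φ ψ η K) :=
  Primrec.list_foldr (h := fun _ p => nfStep φ ψ η K p.1 p.2) Primrec.id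
    (Primrec.const (([], []) : NFState r m n)) ((primrec_nfStep φ ψ η K).comp (Primrec.fst.comp Primrec.snd) (Primrec.snd.comp Primrec.snd))

/-- The syllables given by a list of words. -/
def sylOf (l : List (Bool × GroupWord (Fin m ⊕ Fin n))) : Syl (FreeFactor m n) :=
  l.map fun t => ⟨t.1, factorProj m n t.1 (FreeGroup.mk t.2)⟩

/-- All entries of a list of words for syllables are words for elements of the right factor. -/
def SylValid (l : List (Bool × GroupWord (Fin m ⊕ Fin n))) : Prop :=
  ∀ t ∈ l, FreeGroup.mk t.2 = factorEmb m n t.1 (factorProj m n t.1 (FreeGroup.mk t.2))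

/-- The constant `K` bounds the lengths of words for elements of `C`. -/
def IsDistortionConst (K : ℕ) : Prop :=
  ∀ i (w : GroupWord (Fin m ⊕ Fin n)) (c : C),
    FreeGroup.mk w = factorEmb m n i (factorHom φ ψ i c) →
      ∃ z : GroupWord (Fin r), η (FreeGroup.mk z) = c ∧ z.length ≤ K * w.length

/-- Undistortedness of `C` in both factors is what turns membership in `C` into the finite search
`findBase`. -/
lemma exists_isDistortionConst (hη : Function.Surjective η) (hφ : Function.Injective φ)
    (hψ : Function.Injective ψ) :
    ∃ K, IsDistortionConst φ ψ η K := by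
  obtain ⟨K, hK⟩ := FreeGroup.exists_preimage_norm_le hη φ hφ
  obtain ⟨K', hK'⟩ := FreeGroup.exists_preimage_norm_le hη ψ hψ
  obtain ⟨D, hD⟩ := exists_factorLen_factorProj_le (m := m) (n := n)
  have key : ∀ i (c : C), ∃ z, η z = c ∧
      FreeGroup.norm z ≤ (K + K') * factorLen i (factorHom φ ψ i c) := by
    rintro (_ | _) c
    · obtain ⟨z, h, h'⟩ := hK c
      exact ⟨z, h, h'.trans (Nat.mul_le_mul_right _ (Nat.le_add_right _ _))⟩
    · obtain ⟨z, h, h'⟩ := hK' c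
      exact ⟨z, h, h'.trans (Nat.mul_le_mul_right _ (Nat.le_add_left _ _))⟩
  refine ⟨(K + K') * D, fun i w c h => ?_⟩
  obtain ⟨z, hz, hz'⟩ := key i c
  refine ⟨z.toWord, by rwa [FreeGroup.mk_toWord], hz'.trans ?_⟩
  have := hD i w
  rw [h, factorProj_factorEmb] at this
  rw [mul_assoc]
  exact Nat.mul_le_mul_left _ this

variable {φ ψ η}

lemma findBase_eq_some {K : ℕ} {i : Bool} {w : GroupWord (Fin m ⊕ Fin n)} {x : FreeFactor m n i}
    {z : GroupWord (Fin r)} (hx : FreeGroup.mk w = factorEmb m n i x)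
    (h : findBase φ ψ η K i w = some z) : factorHom φ ψ i (η (FreeGroup.mk z)) = x := by
  have := (List.mem_filter.1 (List.mem_of_head? h)).2
  rw [decide_eq_true_iff, ← FreeGroup.mul_mk, ← FreeGroup.inv_mk, mk_baseWord, hx,
    mul_inv_eq_one] at this
  rw [← factorProj_factorEmb i x, this, factorProj_factorEmb]

lemma findBase_eq_none {K : ℕ} (hK : IsDistortionConst φ ψ η K) {i : Bool}
    {w : GroupWord (Fin m ⊕ Fin n)} {x : FreeFactor m n i}
    (hx : FreeGroup.mk w = factorEmb m n i x) (h : findBase φ ψ η K i w = none) :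
    x ∉ (factorHom φ ψ i).range := by
  rintro ⟨c, rfl⟩
  obtain ⟨z, rfl, hz⟩ := hK i w c hx
  rw [findBase, List.head?_eq_none_iff, List.filter_eq_nil_iff] at h
  refine h z ((mem_wordsLE (by simp)).2 hz) ?_
  rw [decide_eq_true_iff, ← FreeGroup.mul_mk, ← FreeGroup.inv_mk, mk_baseWord, hx, mul_inv_cancel]

/-- The element of the amalgamated product represented by a state. -/
def NFState.val (φ : C →* FreeGroup (Fin m)) (ψ : C →* FreeGroup (Fin n))
    (η : FreeGroup (Fin r) →* C) (s : NFState r m n) : PushoutI (factorHom φ ψ) :=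
  PushoutI.base _ (η (FreeGroup.mk s.1)) * prod (factorHom φ ψ) (sylOf s.2)

/-- The new element either falls into `C` and becomes the base word, or becomes a syllable; `hi`
keeps the list alternating in the latter case. -/
lemma putSyllable_spec {K : ℕ} (hK : IsDistortionConst φ ψ η K) {i : Bool}
    {w : GroupWord (Fin m ⊕ Fin n)} {x : FreeFactor m n i}
    (hx : FreeGroup.mk w = factorEmb m n i x) {l : List (Bool × GroupWord (Fin m ⊕ Fin n))}
    (hl : IsRed (factorHom φ ψ) (sylOf l)) (hv : SylValid l) (hi : ∀ t ∈ l.head?, i ≠ t.1) :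
    NFState.val φ ψ η (putSyllable φ ψ η K i w l) =
      PushoutI.of i x * prod (factorHom φ ψ) (sylOf l) ∧
    IsRed (factorHom φ ψ) (sylOf (putSyllable φ ψ η K i w l).2) ∧
    SylValid (putSyllable φ ψ η K i w l).2 := by
  rw [putSyllable]
  cases h : findBase φ ψ η K i w with
  | some z =>
    refine ⟨?_, hl, hv⟩
    rw [NFState.val, ← findBase_eq_some hx h, PushoutI.of_apply_eq_base]
  | none =>
    refine ⟨?_, ?_, ?_⟩
    · rw [NFState.val, ← FreeGroup.one_eq_mk, map_one, map_one, one_mul]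
      simp only [sylOf, List.map_cons, prod_cons, hx, factorProj_factorEmb]
    · have := findBase_eq_none hK hx h
      simp only [sylOf, List.map_cons, hx, factorProj_factorEmb]
      refine isRed_cons_iff.2 ⟨this, hl, ?_⟩
      cases l with
      | nil => simp
      | cons t l => simpa using hi t (by simp)
    · intro t ht
      rcases List.mem_cons.1 ht with rfl | ht
      · rw [hx, factorProj_factorEmb]
      · exact hv t ht

lemma nfStep_spec {K : ℕ} (hK : IsDistortionConst φ ψ η K) (x : (Fin m ⊕ Fin n) × Bool)
    {s : NFState r m n} (hl : IsRed (factorHom φ ψ) (sylOf s.2)) (hv : SylValid s.2) :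
    NFState.val φ ψ η (nfStep φ ψ η K x s) = evalG φ ψ [x] * NFState.val φ ψ η s ∧
    IsRed (factorHom φ ψ) (sylOf (nfStep φ ψ η K x s).2) ∧
    SylValid (nfStep φ ψ η K x s).2 := by
  have hx := mk_letter x
  have hw : FreeGroup.mk (x :: baseWord φ ψ η x.1.isRight s.1) = factorEmb m n x.1.isRight
      (factorProj m n x.1.isRight (FreeGroup.mk [x]) *
        factorHom φ ψ x.1.isRight (η (FreeGroup.mk s.1))) := by
    rw [map_mul, ← hx, ← mk_baseWord, FreeGroup.mul_mk]
    rfl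
  rw [evalG_eq_of φ ψ hx]
  obtain ⟨z, l⟩ := s
  cases l with
  | nil =>
    simp only [nfStep]
    have := putSyllable_spec hK hw hl hv (by simp)
    rwa [map_mul, PushoutI.of_apply_eq_base, mul_assoc] at this
  | cons t l =>
    simp only [nfStep]
    split_ifs with ht
    · obtain ⟨j, w⟩ := t
      simp only at ht
      subst ht
      have hw' : FreeGroup.mk (x :: (baseWord φ ψ η x.1.isRight z ++ w)) =
          factorEmb m n x.1.isRight (factorProj m n x.1.isRight (FreeGroup.mk [x]) *
            factorHom φ ψ x.1.isRight (η (FreeGroup.mk z)) *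
              factorProj m n x.1.isRight (FreeGroup.mk w)) := by
        rw [map_mul, ← hw, ← hv _ List.mem_cons_self, FreeGroup.mul_mk]
        rfl
      have hl' := isRed_cons_iff.1 hl
      have := putSyllable_spec hK hw' hl'.2.1 (fun t ht => hv t (List.mem_cons_of_mem _ ht)) (by
        cases l with
        | nil => simp
        | cons t l => simpa [sylOf] using hl'.2.2)
      rw [map_mul, map_mul, PushoutI.of_apply_eq_base, mul_assoc, mul_assoc] at this
      exact this
    · have := putSyllable_spec hK hw hl hv (by simpa [eq_comm] using ht)
      rwa [map_mul, PushoutI.of_apply_eq_base, mul_assoc] at this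

lemma normalForm_spec {K : ℕ} (hK : IsDistortionConst φ ψ η K)
    (w : GroupWord (Fin m ⊕ Fin n)) :
    NFState.val φ ψ η (normalForm φ ψ η K w) = evalG φ ψ w ∧
    IsRed (factorHom φ ψ) (sylOf (normalForm φ ψ η K w).2) ∧
    SylValid (normalForm φ ψ η K w).2 := by
  induction w with
  | nil =>
    refine ⟨?_, isRed_nil, by simp [normalForm, SylValid]⟩
    simp [normalForm, NFState.val, sylOf, evalG, ← FreeGroup.one_eq_mk]
  | cons x w ih =>
    obtain ⟨h1, h2, h3⟩ := nfStep_spec hK x ih.2.1 ih.2.2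
    refine ⟨?_, h2, h3⟩
    change NFState.val φ ψ η (nfStep φ ψ η K x (normalForm φ ψ η K w)) = _
    rw [h1, ih.1, evalG, evalG, ← GroupWord.eval_append]
    rfl

end NormalForm

/-! ### The certificate and the search -/

section Algorithm

open Syl

variable {m n : ℕ} {C : Type*} [Group C] {φ : C →* FreeGroup (Fin m)} {ψ : C →* FreeGroup (Fin n)}

/-- The functions `τ` and `σ` compute the tags and a bound for the size of a normal form of the
element given by a word. -/
structure ComputesNormalForm (φ : C →* FreeGroup (Fin m)) (ψ : C →* FreeGroup (Fin n))
    (τ : GroupWord (Fin m ⊕ Fin n) → List Bool) (σ : GroupWord (Fin m ⊕ Fin n) → ℕ) : Prop where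
  primrec_tags : Primrec τ
  primrec_size : Primrec σ
  primrecPred_eq_one : PrimrecPred fun w => evalG φ ψ w = 1
  exists_form : ∀ w, ∃ c l, PushoutI.base _ c * prod (factorHom φ ψ) l = evalG φ ψ w ∧
    IsRed (factorHom φ ψ) l ∧ l.tags = τ w ∧ SizeLE φ ψ c l (σ w)

/-- A bound in terms of word lengths alone is primitive recursive; its last summand pays for the `+
1` per syllable in `sylSize`. -/
lemma exists_sizeLE {r : ℕ} (η : FreeGroup (Fin r) →* C) : ∃ D, ∀ s : NFState r m n,
    SizeLE φ ψ (η (FreeGroup.mk s.1)) (sylOf s.2)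
      (D * (s.1.length + (s.2.flatMap Prod.snd).length) + s.2.length) := by
  obtain ⟨D, hD⟩ := FreeGroup.exists_norm_map_le (φ.comp η)
  obtain ⟨D', hD'⟩ := FreeGroup.exists_norm_map_le (ψ.comp η)
  obtain ⟨E, hE⟩ := exists_factorLen_factorProj_le (m := m) (n := n)
  have h1 : ∀ i (z : GroupWord (Fin r)),
      factorLen i (factorHom φ ψ i (η (FreeGroup.mk z))) ≤ (D + D' + E) * z.length := by
    rintro (_ | _) z
    · exact (hD _).trans (Nat.mul_le_mul (by omega) FreeGroup.norm_mk_le)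
    · exact (hD' _).trans (Nat.mul_le_mul (by omega) FreeGroup.norm_mk_le)
  have h2 : ∀ l : List (Bool × GroupWord (Fin m ⊕ Fin n)),
      sylSize (sylOf l) ≤ (D + D' + E) * (l.flatMap Prod.snd).length + l.length := by
    intro l
    induction l with
    | nil => simp [sylOf, sylSize]
    | cons t l ih =>
      have := (hE t.1 t.2).trans (Nat.mul_le_mul_right _ (by omega : E ≤ D + D' + E))
      simp only [sylOf, sylSize, List.map_cons, List.sum_cons, List.flatMap_cons,
        List.length_append, List.length_cons, mul_add] at ih ⊢
      omega
  refine ⟨D + D' + E, fun s i => ?_⟩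
  have := h1 i s.1
  have := h2 s.2
  rw [mul_add]
  omega

lemma exists_computesNormalForm [Group.FG C] (hφ : Function.Injective φ)
    (hψ : Function.Injective ψ) : ∃ τ σ, ComputesNormalForm φ ψ τ σ := by
  obtain ⟨α, _, η', hη'⟩ := Group.fg_iff_exists_freeGroup_hom_surjective_finite.1 ‹Group.FG C›
  obtain ⟨r, ⟨e⟩⟩ := Finite.exists_equiv_fin α
  obtain ⟨η, hη⟩ : ∃ η : FreeGroup (Fin r) →* C, Function.Surjective η :=
    ⟨η'.comp (FreeGroup.freeGroupCongr e).symm.toMonoidHom,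
      hη'.comp (FreeGroup.freeGroupCongr e).symm.surjective⟩
  obtain ⟨K, hK⟩ := exists_isDistortionConst φ ψ η hη hφ hψ
  obtain ⟨D, hD⟩ := exists_sizeLE (m := m) (n := n) (φ := φ) (ψ := ψ) η
  have hnf := primrec_normalForm φ ψ η K
  have htags : ∀ w, (sylOf (normalForm φ ψ η K w).2).tags =
      (normalForm φ ψ η K w).2.map Prod.fst := fun w => by
    simp [sylOf, tags, Function.comp_def]
  -- The word problem. As `η` need not be injective, the base word is tested through its image in a
  -- factor.
  have hone : ∀ w, evalG φ ψ w = 1 ↔ (normalForm φ ψ η K w).2 = [] ∧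
      FreeGroup.mk (baseWord φ ψ η false (normalForm φ ψ η K w).1) = 1 := by
    intro w
    obtain ⟨h1, h2, -⟩ := normalForm_spec hK w
    have hθ := factorHom_injective hφ hψ
    rw [← h1, NFState.val, mk_baseWord]
    have hb : ∀ x : FreeFactor m n false, factorEmb m n false x = 1 ↔ x = 1 := fun x =>
      ⟨fun h => by rw [← factorProj_factorEmb false x, h, map_one], fun h => by rw [h, map_one]⟩
    rw [hb, map_eq_one_iff _ (hθ false)]
    constructor
    · intro h
      have h3 : sylOf (normalForm φ ψ η K w).2 = [] := eq_nil_of_prod_mem hθ h2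
        (by rw [eq_inv_of_mul_eq_one_right h]; exact inv_mem (MonoidHom.mem_range.2 ⟨_, rfl⟩))
      rw [h3, prod_nil, mul_one, map_eq_one_iff _ (PushoutI.base_injective hθ)] at h
      exact ⟨List.map_eq_nil_iff.1 h3, h⟩
    · rintro ⟨h3, h4⟩
      rw [h3, h4]
      simp [sylOf]
  refine ⟨fun w => (normalForm φ ψ η K w).2.map Prod.fst,
    fun w => D * ((normalForm φ ψ η K w).1.length +
      ((normalForm φ ψ η K w).2.flatMap Prod.snd).length) + (normalForm φ ψ η K w).2.length,
    Primrec.list_map (Primrec.snd.comp hnf) (Primrec.fst.comp Primrec.snd), ?_,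
    PrimrecPred.of_eq (PrimrecPred.and ?_ ?_) fun w => (hone w).symm, fun w => ?_⟩
  · have h1 := Primrec.list_length.comp (Primrec.fst.comp hnf)
    have h2 := Primrec.list_length.comp (Primrec.snd.comp hnf)
    have h3 := Primrec.list_length.comp (Primrec.list_flatMap (g := fun _ t => t.2)
      (Primrec.snd.comp hnf) (Primrec.snd.comp Primrec.snd).to₂)
    exact Primrec.nat_add.comp (Primrec.nat_mul.comp (Primrec.const D)
      (Primrec.nat_add.comp h1 h3)) h2
  · exact Primrec.eq.comp (Primrec.snd.comp hnf) (Primrec.const [])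
  · exact FreeGroup.primrecPred_mk_eq_one.comp
      ((primrec_baseWord φ ψ η).comp (Primrec.const false) (Primrec.fst.comp hnf))
  · obtain ⟨h1, h2, -⟩ := normalForm_spec hK w
    exact ⟨_, _, h1, h2, htags w, hD _⟩

variable {τ : GroupWord (Fin m ⊕ Fin n) → List Bool} {σ : GroupWord (Fin m ⊕ Fin n) → ℕ}

lemma ComputesNormalForm.tags_eq (h : ComputesNormalForm φ ψ τ σ) (hφ : Function.Injective φ)
    (hψ : Function.Injective ψ) {w : GroupWord (Fin m ⊕ Fin n)} {c : C}
    {l : Syl (FreeFactor m n)} (hl : IsRed (factorHom φ ψ) l)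
    (hw : evalG φ ψ w = PushoutI.base _ c * prod (factorHom φ ψ) l) : τ w = l.tags := by
  obtain ⟨c', l', h1, h2, h3, -⟩ := h.exists_form w
  rw [← h3]
  exact tags_eq_of_eq (factorHom_injective hφ hψ) (a := c') (b := 1) (c := c) (d := 1) h2 hl
    (by rw [map_one, mul_one, mul_one, h1, hw])

lemma ComputesNormalForm.tags_eq_nil_iff (h : ComputesNormalForm φ ψ τ σ)
    (hφ : Function.Injective φ) (hψ : Function.Injective ψ) (w : GroupWord (Fin m ⊕ Fin n)) :
    τ w = [] ↔ evalG φ ψ w ∈ (PushoutI.base (factorHom φ ψ)).range := by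
  constructor
  · intro hw
    obtain ⟨c, l, h1, h2, h3, -⟩ := h.exists_form w
    rw [hw] at h3
    rw [← h1, List.map_eq_nil_iff.1 h3, prod_nil, mul_one]
    exact MonoidHom.mem_range.2 ⟨c, rfl⟩
  · rintro ⟨c, hc⟩
    exact h.tags_eq hφ hψ (l := []) isRed_nil (c := c) (by simp [hc])

/-- The conjugate `z⁻¹ u z`, as a word. -/
def conjWord {X : Type*} (z u : GroupWord X) : GroupWord X := FreeGroup.invRev z ++ u ++ z

@[simp] lemma eval_conjWord {X G : Type*} [Group G] (γ : X → G) (z u : GroupWord X) :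
    (conjWord z u).eval γ = (z.eval γ)⁻¹ * u.eval γ * z.eval γ := by
  simp [conjWord, mul_assoc]

lemma primrec_conjWord {X : Type*} [Primcodable X] :
    Primrec₂ (conjWord : GroupWord X → GroupWord X → GroupWord X) :=
  Primrec.list_append.comp (Primrec.list_append.comp (FreeGroup.primrec_invRev.comp Primrec.fst)
    Primrec.snd) Primrec.fst

/-- A condition which can be checked, and which implies that `u` and `v` are not conjugate. -/
def NonConjCertificate (φ : C →* FreeGroup (Fin m)) (ψ : C →* FreeGroup (Fin n))
    (τ : GroupWord (Fin m ⊕ Fin n) → List Bool) (B : ℕ) (u v : GroupWord (Fin m ⊕ Fin n)) :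
    Prop :=
  (CycTags (τ v) ∧ ∀ z : GroupWord (Fin m ⊕ Fin n), z.length ≤ B →
    evalG φ ψ (conjWord z u) ≠ evalG φ ψ v) ∧
  (evalG φ ψ u = 1 ∨
    (((τ u).length ≤ 1 ∧ ∀ z : GroupWord (Fin m ⊕ Fin n), z.length ≤ B →
      τ (conjWord z u) = [] → τ z = []) ∨
    ((τ u).head? ≠ (τ u).getLast? ∧ ∀ z : GroupWord (Fin m ⊕ Fin n), z.length ≤ B →
      τ z = [] → τ (conjWord u z) = [] → evalG φ ψ z = 1)))

lemma PrimrecRel.forall_length_le {α β : Type*} [Primcodable α] [Fintype α] [Primcodable β]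
    {R : List α → β → Prop} (hR : PrimrecRel R) {B : β → ℕ} (hB : Primrec B) :
    PrimrecPred fun b => ∀ z : List α, z.length ≤ B b → R z b :=
  (hR.forall_mem_list.comp ((primrec_wordsLE (Finset.univ : Finset α).toList).comp hB)
    Primrec.id).of_eq fun b => by simp [mem_wordsLE]

lemma PrimrecPred.imp {α : Type*} [Primcodable α] {p q : α → Prop} (hp : PrimrecPred p)
    (hq : PrimrecPred q) : PrimrecPred fun a => p a → q a :=
  (hp.not.or hq).of_eq fun _ => imp_iff_not_or.symm

lemma ComputesNormalForm.primrecRel_eq (h : ComputesNormalForm φ ψ τ σ) :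
    PrimrecRel fun u v => evalG φ ψ u = evalG φ ψ v := by
  refine (h.primrecPred_eq_one.comp (Primrec.list_append.comp (FreeGroup.primrec_invRev.comp
    Primrec.fst) Primrec.snd)).of_eq fun p => ?_
  rw [evalG, GroupWord.eval_append, GroupWord.eval_invRev, inv_mul_eq_one]

lemma primrecPred_cycTags : PrimrecPred CycTags :=
  PrimrecPred.or (Primrec.nat_le.comp Primrec.list_length (Primrec.const 1))
    (Primrec.eq.comp Primrec.list_head? ((Primrec.list_head?.comp Primrec.list_reverse).of_eq
      fun _ => List.head?_reverse)).not

lemma ComputesNormalForm.primrecRel_nonConjCertificate (h : ComputesNormalForm φ ψ τ σ) (s κ : ℕ) :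
    PrimrecRel fun u v => NonConjCertificate φ ψ τ (conjBound s κ (σ u + σ v)) u v := by
  have hB : Primrec fun p : GroupWord (Fin m ⊕ Fin n) × GroupWord (Fin m ⊕ Fin n) =>
      conjBound s κ (σ p.1 + σ p.2) := (primrec_conjBound s κ).comp
    (Primrec.nat_add.comp (h.primrec_size.comp Primrec.fst) (h.primrec_size.comp Primrec.snd))
  have hnil : PrimrecPred fun w => τ w = [] :=
    Primrec.eq.comp h.primrec_tags (Primrec.const [])
  have hu := h.primrec_tags.comp (Primrec.fst (α := GroupWord (Fin m ⊕ Fin n))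
    (β := GroupWord (Fin m ⊕ Fin n)))
  have hz : Primrec fun q : GroupWord (Fin m ⊕ Fin n) × GroupWord (Fin m ⊕ Fin n) ×
      GroupWord (Fin m ⊕ Fin n) => q.2.1 := Primrec.fst.comp Primrec.snd
  refine ((primrecPred_cycTags.comp (h.primrec_tags.comp Primrec.snd)).and ?_).and
    ((h.primrecPred_eq_one.comp Primrec.fst).or ((PrimrecPred.and ?_ ?_).or
      (PrimrecPred.and ?_ ?_)))
  · exact PrimrecRel.forall_length_le (R := fun z (p : GroupWord (Fin m ⊕ Fin n) ×
        GroupWord (Fin m ⊕ Fin n)) =>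
      evalG φ ψ (conjWord z p.1) ≠ evalG φ ψ p.2) (h.primrecRel_eq.comp
        (primrec_conjWord.comp Primrec.fst hz) (Primrec.snd.comp Primrec.snd)).not hB
  · exact Primrec.nat_le.comp (Primrec.list_length.comp hu) (Primrec.const 1)
  · exact PrimrecRel.forall_length_le (R := fun z (p : GroupWord (Fin m ⊕ Fin n) ×
        GroupWord (Fin m ⊕ Fin n)) => τ (conjWord z p.1) = [] → τ z = [])
      ((hnil.comp (primrec_conjWord.comp Primrec.fst hz)).imp (hnil.comp Primrec.fst)) hB
  · exact (Primrec.eq.comp (Primrec.list_head?.comp hu) ((Primrec.list_head?.comp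
      (Primrec.list_reverse.comp hu)).of_eq fun _ => List.head?_reverse)).not
  · exact PrimrecRel.forall_length_le (R := fun z (p : GroupWord (Fin m ⊕ Fin n) ×
        GroupWord (Fin m ⊕ Fin n)) =>
      τ z = [] → τ (conjWord p.1 z) = [] → evalG φ ψ z = 1)
      ((hnil.comp Primrec.fst).imp ((hnil.comp (primrec_conjWord.comp hz Primrec.fst)).imp
        (h.primrecPred_eq_one.comp Primrec.fst))) hB

lemma NonConjCertificate.not_conj (h : ComputesNormalForm φ ψ τ σ) (hφ : Function.Injective φ)
    (hψ : Function.Injective ψ) {κ : ℕ} (hκ : IsQuasiconvexConst φ ψ κ)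
    {u v : GroupWord (Fin m ⊕ Fin n)}
    (hc : NonConjCertificate φ ψ τ (conjBound (numLetters m n) κ (σ u + σ v)) u v)
    (z : PushoutI (factorHom φ ψ)) : z⁻¹ * evalG φ ψ u * z ≠ evalG φ ψ v := by
  intro hz
  obtain ⟨⟨hcyc, hne⟩, hu⟩ := hc
  obtain ⟨c, l, h1, h2, h3, h4⟩ := h.exists_form u
  obtain ⟨d, l', h1', h2', h3', h4'⟩ := h.exists_form v
  replace h4 : SizeLE φ ψ c l (σ u + σ v) := fun i => (h4 i).trans (Nat.le_add_right _ _)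
  replace h4' : SizeLE φ ψ d l' (σ u + σ v) := fun i => (h4' i).trans (Nat.le_add_left _ _)
  simp only [h.tags_eq_nil_iff hφ hψ, evalG, eval_conjWord] at hne hu
  simp only [evalG] at hz h1 h1'
  rw [← h3'] at hcyc
  -- A trivial `u` is conjugated into `C` by every element, so it has its own clause: there the
  -- empty word already conjugates `u` to `v`.
  rcases hu with hu | ⟨hlen, hE⟩ | ⟨hh, hE⟩
  · refine hne [] (Nat.zero_le _) ?_
    rw [← hz, hu]
    simp
  · rw [← h3, length_tags] at hlen
    rw [← h1, ← h1'] at hz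
    rw [← h1] at hE
    obtain ⟨w, hw, hw'⟩ := exists_short_conj_of_elliptic hφ hψ hκ h2 h2' h4 h4' hlen hE hcyc hz
    exact hne w hw (by rw [← h1, ← h1']; exact hw')
  · rw [← h3] at hh
    rw [← h1, ← h1'] at hz
    rw [← h1] at hE
    obtain ⟨w, hw, hw'⟩ := exists_short_conj_of_hyperbolic hφ hψ hκ h2 h2' h4 h4' hh hE hcyc hz
    exact hne w hw (by rw [← h1, ← h1']; exact hw')

open Classical in
/-- The partial algorithm: search for a conjugator and for a certificate. -/
noncomputable def conjSearch (φ : C →* FreeGroup (Fin m)) (ψ : C →* FreeGroup (Fin n))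
    (τ : GroupWord (Fin m ⊕ Fin n) → List Bool) (B : GroupWord (Fin m ⊕ Fin n) →
      GroupWord (Fin m ⊕ Fin n) → ℕ) (p : GroupWord (Fin m ⊕ Fin n) × GroupWord (Fin m ⊕ Fin n)) :
    Part (Option (GroupWord (Fin m ⊕ Fin n))) :=
  Nat.rfindOpt fun k => (Encodable.decode k :
      Option (GroupWord (Fin m ⊕ Fin n) × GroupWord (Fin m ⊕ Fin n))).bind fun q =>
    if evalG φ ψ (conjWord q.1 p.1) = evalG φ ψ p.2 then some (some q.1)
    else if NonConjCertificate φ ψ τ (B (conjWord q.1 p.1) (conjWord q.2 p.2))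
      (conjWord q.1 p.1) (conjWord q.2 p.2) then some none
    else none

lemma ComputesNormalForm.partrec_conjSearch (h : ComputesNormalForm φ ψ τ σ) (s κ : ℕ) :
    Partrec (conjSearch φ ψ τ fun u v => conjBound s κ (σ u + σ v)) := by
  classical
  refine Partrec.rfindOpt (Primrec.to_comp ?_)
  have hp1 : Primrec fun x : ((GroupWord (Fin m ⊕ Fin n) × GroupWord (Fin m ⊕ Fin n)) × ℕ) ×
      (GroupWord (Fin m ⊕ Fin n) × GroupWord (Fin m ⊕ Fin n)) => x.1.1.1 :=
    Primrec.fst.comp (Primrec.fst.comp Primrec.fst)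
  have hp2 : Primrec fun x : ((GroupWord (Fin m ⊕ Fin n) × GroupWord (Fin m ⊕ Fin n)) × ℕ) ×
      (GroupWord (Fin m ⊕ Fin n) × GroupWord (Fin m ⊕ Fin n)) => x.1.1.2 :=
    Primrec.snd.comp (Primrec.fst.comp Primrec.fst)
  have hq1 := primrec_conjWord.comp (Primrec.fst.comp Primrec.snd) hp1
  have hq2 := primrec_conjWord.comp (Primrec.snd.comp Primrec.snd) hp2
  refine Primrec.option_bind (Primrec.decode.comp Primrec.snd)
    (Primrec.ite (h.primrecRel_eq.comp hq1 hp2)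
      (Primrec.option_some.comp (Primrec.option_some.comp (Primrec.fst.comp Primrec.snd)))
      (Primrec.ite ((h.primrecRel_nonConjCertificate s κ).comp hq1 hq2)
        (Primrec.const (some none)) (Primrec.const none)))

end Algorithm

section Completeness

open Syl

variable {m n : ℕ} {C : Type*} [Group C] {φ : C →* FreeGroup (Fin m)} {ψ : C →* FreeGroup (Fin n)}

lemma mem_conjSubgroup {G : Type*} [Group G] {H : Subgroup G} {g x : G} (hx : x ∈ H) :
    g⁻¹ * x * g ∈ conjSubgroup H g :=
  ⟨x, hx, by simp⟩

/-- If `g ∉ H`, the nontrivial element `g⁻¹ * u * g` would put `g` into the generalized normalizer,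
and then `u` into `zSet H`. -/
lemma IsRegularElt.mem_of_conj_mem {G : Type*} [Group G] {H : Subgroup G} {u : G}
    (h : IsRegularElt H u) (hu : u ∈ H) (h1 : u ≠ 1) {g : G} (hg : g⁻¹ * u * g ∈ H) : g ∈ H := by
  by_contra hgH
  refine h (Or.inr (Set.mem_iUnion₂.2 ⟨g, ⟨fun hbot => h1 ?_, hgH⟩, hu, hg⟩))
  have : g⁻¹ * u * g ∈ H ⊓ conjSubgroup H g := ⟨hg, mem_conjSubgroup hu⟩
  rwa [hbot, Subgroup.mem_bot, ← inv_inv g, inv_inv g⁻¹, conj_eq_one_iff] at this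

/-- A nontrivial such `g` would put `u` itself into the generalized normalizer, outside `H`. -/
lemma IsRegularElt.eq_one_of_conj_mem {G : Type*} [Group G] {H : Subgroup G} {u : G}
    (h : IsRegularElt H u) (hu : u ∉ H) {g : G} (hg : g ∈ H) (hg' : u⁻¹ * g * u ∈ H) : g = 1 := by
  by_contra h1
  refine h (Or.inl ⟨fun hbot => h1 ?_, hu⟩)
  have : u⁻¹ * g * u ∈ H ⊓ conjSubgroup H u := ⟨hg', mem_conjSubgroup hg⟩
  rwa [hbot, Subgroup.mem_bot, ← inv_inv u, inv_inv u⁻¹, conj_eq_one_iff] at this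

lemma exists_evalG_eq (g : PushoutI (factorHom φ ψ)) : ∃ w, evalG φ ψ w = g := by
  obtain ⟨l, c, rfl, -⟩ := exists_form g
  refine ⟨sylWord l ++ factorWord false (factorHom φ ψ false c), ?_⟩
  rw [evalG, GroupWord.eval_append, ← evalG, ← evalG, evalG_sylWord, evalG_factorWord,
    PushoutI.of_apply_eq_base]

variable {τ : GroupWord (Fin m ⊕ Fin n) → List Bool} {σ : GroupWord (Fin m ⊕ Fin n) → ℕ}

/-- Regularity gives the conditions for all `z`, hence for every bound `B`. For `n = 0` it is the
condition on elements of `C`, for `n = 1` the condition is vacuous as `u` has no conjugate in `C`,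
and for `n ≥ 2` it says `C ∩ C^u = 1`. -/
lemma nonConjCertificate_of_isRegularElt (h : ComputesNormalForm φ ψ τ σ)
    (hφ : Function.Injective φ) (hψ : Function.Injective ψ) {u v : GroupWord (Fin m ⊕ Fin n)}
    (hu : Amalgam.IsCyclicallyReduced φ ψ (evalG φ ψ u))
    (hreg : IsRegularElt (Amalgam.amalgamated φ ψ) (evalG φ ψ u)) (hv : CycTags (τ v))
    (huv : ∀ z : GroupWord (Fin m ⊕ Fin n), evalG φ ψ (conjWord z u) ≠ evalG φ ψ v) (B : ℕ) :
    NonConjCertificate φ ψ τ B u v := by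
  refine ⟨⟨hv, fun z _ => huv z⟩, ?_⟩
  obtain ⟨c, w, ⟨hred, hcw⟩, hn⟩ := hu
  have hl : IsRed (factorHom φ ψ) w.toList := by
    refine ⟨fun s hs => hred s hs, ?_⟩
    rw [tags, List.isChain_map]
    exact w.chain_ne
  have hprod : PushoutI.ofCoprodI (φ := factorHom φ ψ) w.prod =
      prod (factorHom φ ψ) w.toList := by
    simp [Syl.prod, CoprodI.Word.prod, map_list_prod, Function.comp_def]
  rw [hprod] at hcw
  have htag := h.tags_eq hφ hψ hl hcw
  simp only [h.tags_eq_nil_iff hφ hψ]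
  have hiff := h.tags_eq_nil_iff hφ hψ u
  rw [htag, evalG] at hiff
  simp only [evalG, eval_conjWord, htag] at hreg hiff ⊢
  rcases hn with hn | ⟨hn, hnc⟩ | ⟨hn, a, ha, b, hb, hab⟩
  · rw [List.length_eq_zero_iff] at hn
    by_cases h1 : u.eval (Amalgam.gen φ ψ) = 1
    · exact Or.inl h1
    · refine Or.inr (Or.inl ⟨by simp [hn], fun z _ hz => ?_⟩)
      exact hreg.mem_of_conj_mem (hiff.1 (by rw [hn]; rfl)) h1 hz
  · refine Or.inr (Or.inl ⟨by simp [hn], fun z _ hz => ?_⟩)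
    refine absurd ?_ (hnc _ hz)
    exact isConj_iff.2 ⟨(z.eval (Amalgam.gen φ ψ))⁻¹, by simp⟩
  · refine Or.inr (Or.inr ⟨?_, fun z _ hz hz' => ?_⟩)
    · rw [tags, List.head?_map, List.getLast?_map, ha, hb]
      simpa using hab
    · refine hreg.eq_one_of_conj_mem (fun hu => ?_) hz hz'
      have := hiff.2 hu
      rw [← List.length_eq_zero_iff, length_tags] at this
      omega

end Completeness

theorem corollary4p19 (m n : ℕ) (C : Type v) [Group C] [Group.FG C]
    (φ : C →* FreeGroup (Fin m)) (ψ : C →* FreeGroup (Fin n))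
    (hφ : Function.Injective φ) (hψ : Function.Injective ψ) :
    ConjSearchDecidableOn (Amalgam.gen φ ψ) (Amalgam.CR φ ψ ×ˢ (Set.univ : Set (Amalgam φ ψ))) := by
  obtain ⟨τ, σ, h⟩ := exists_computesNormalForm hφ hψ
  obtain ⟨α, _, η, hη⟩ := Group.fg_iff_exists_freeGroup_hom_surjective_finite.1 ‹Group.FG C›
  obtain ⟨κ, hκ⟩ := exists_isQuasiconvexConst hη hφ hψ
  refine ⟨_, h.partrec_conjSearch (numLetters m n) κ, fun u v r hr => ?_, fun u v huv => ?_⟩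
  · obtain ⟨k, hk⟩ := Nat.rfindOpt_spec hr
    obtain ⟨⟨s, t⟩, -, hst⟩ := Option.bind_eq_some_iff.1 hk
    split_ifs at hst with h1 h2
    · cases hst
      rwa [evalG, eval_conjWord] at h1
    · cases hst
      intro hconj
      obtain ⟨z, hz⟩ := isConj_iff.1 hconj
      -- The certificate concerns the conjugates of `u` by `s` and of `v` by `t`, so the conjugator
      -- is adjusted on both sides.
      refine h2.not_conj h hφ hψ hκ ((s.eval (Amalgam.gen φ ψ))⁻¹ * z⁻¹ *
        t.eval (Amalgam.gen φ ψ)) ?_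
      simp only [evalG, eval_conjWord]
      rw [← hz]
      group
  · obtain ⟨⟨g, hg, hreg, hconj⟩, -⟩ := huv
    obtain ⟨z, hz⟩ : ∃ z, z * g * z⁻¹ = evalG φ ψ u := isConj_iff.1 hconj
    obtain ⟨s, hs⟩ := exists_evalG_eq z
    refine Nat.rfindOpt_dom.2 ?_
    by_cases hc : ∃ s, evalG φ ψ (conjWord s u) = evalG φ ψ v
    · obtain ⟨s, hs⟩ := hc
      -- The second entry is irrelevant once `s` is a conjugator.
      refine ⟨Encodable.encode (s, s), some s, ?_⟩
      simp [hs]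
    · push Not at hc
      have hgs : evalG φ ψ (conjWord s u) = g := by
        rw [evalG, eval_conjWord, ← evalG, ← evalG, hs, ← hz]
        group
      obtain ⟨c, l, h1, h2, -⟩ := h.exists_form v
      -- No assumption on `v` is needed, since some conjugate of it always has the required shape.
      obtain ⟨x, l', d, hx, hl', hcyc⟩ := Syl.exists_conj_cycTags l c h2
      obtain ⟨t, ht⟩ := exists_evalG_eq x
      refine ⟨Encodable.encode (s, t), none, ?_⟩
      have hcert := nonConjCertificate_of_isRegularElt h hφ hψ (u := conjWord s u)
        (v := conjWord t v) (by rwa [hgs]) (by rwa [hgs]) (by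
          rw [h.tags_eq hφ hψ hl' (c := d)]
          · exact hcyc
          · rw [evalG, eval_conjWord, ← evalG, ← evalG, ht, ← h1, hx]) (fun y hy => by
          refine hc (s ++ y ++ FreeGroup.invRev t) ?_
          simp only [evalG, eval_conjWord, GroupWord.eval_append, GroupWord.eval_invRev] at hy ⊢
          rw [← mul_left_cancel_iff (a := (GroupWord.eval (Amalgam.gen φ ψ) t)⁻¹),
            ← mul_right_cancel_iff (a := GroupWord.eval (Amalgam.gen φ ψ) t), ← hy]
          group)
        (conjBound (numLetters m n) κ (σ (conjWord s u) + σ (conjWord t v)))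
      rw [Encodable.encodek, Option.bind_some, if_neg (hc s), if_pos hcert]
      rfl
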